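/- For $\sigma>0$ let $\mathcal{PW}^1_\sigma$ be the space of all functions $f:\mathbb{C}\to\mathbb{C}$ of the form $f(z)=\frac{1}{2\pi}\int_{-\sigma}^{\sigma}\widehat f(\omega)\,e^{i\omega z}\,d\omega$ with $\widehat f\in L^1([-\sigma,\sigma])$, normed by $\|f\|_{\mathcal{PW}^1_\sigma}=\frac{1}{2\sigma}\int_{-\sigma}^{\sigma}|\widehat f(\omega)|\,d\omega$. A sine-type function is an entire function $\varphi$ of exponential type $\pi$ whose zeros are simple and separated (i.e. the distances between distinct zeros are bounded below by a positive constant) and for which there are constants $a,b,H>0$ with $a\,e^{\pi|\eta|}\le|\varphi(\xi+i\eta)|\le b\,e^{\pi|\eta|}$ for all $\xi\in\mathbb{R}$ and all real $\eta$ with $|\eta|\ge H$. Let $g\in\mathcal{PW}^1_\pi$, let $A>\|g\|_{\mathcal{PW}^1_\pi}$ be a real constant, and suppose that $$\varphi(z)=A\sin(\pi z)-g(z),\qquad z\in\mathbb{C},$$ is a sine-type function. Let $\{\lambda_n\}_{n\in\mathbb{Z}}$ be an enumeration of the zero set of $\varphi$ without repetitions and with $\operatorname{Re}\lambda_n\le\operatorname{Re}\lambda_{n+1}$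 for all $n\in\mathbb{Z}$, and set $$\varphi_n(z)=\frac{\varphi(z)}{\varphi'(\lambda_n)(z-\lambda_n)},\qquad \varphi_n(\lambda_n)=1,\qquad (A_Nf)(z)=\sum_{n=-N}^{N}f(\lambda_n)\,\varphi_n(z).$$ Then the sampling series $A_N$ diverges strongly on $\mathcal{PW}^1_\pi$: there exists a function $f\in\mathcal{PW}^1_\pi$ such that for every $N$ the maximum of $|A_Nf|$ over $\mathbb{R}$ is attained, and $$\lim_{N\to\infty}\|A_Nf\|_{L^\infty(\mathbb{R})}=\lim_{N\to\infty}\Big(\max_{t\in\mathbb{R}}\Big|\sum_{n=-N}^{N}f(\lambda_n)\,\varphi_n(t)\Big|\Big)=\infty.$$ -/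

import Mathlib

open Filter Topology MeasureTheory

noncomputable section

/-- The function `z ↦ (1 / 2π) ∫_{-σ}^{σ} F(ω) e^{iωz} dω` with spectrum `F`. -/
def bandlimited (σ : ℝ) (F : ℝ → ℂ) (z : ℂ) : ℂ :=
  (1 / (2 * Real.pi) : ℂ) * ∫ ω in Set.Icc (-σ) σ, F ω * Complex.exp (Complex.I * ω * z)

/-- `F` is a spectrum of `f`, i.e. `F ∈ L¹([-σ, σ])` and `f` is the inverse Fourier transform
of `F`. By injectivity of the Fourier transform `F` is then determined by `f` almost everywhere
on `[-σ, σ]`. -/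
def IsSpectrum (σ : ℝ) (f : ℂ → ℂ) (F : ℝ → ℂ) : Prop :=
  IntegrableOn F (Set.Icc (-σ) σ) ∧ ∀ z, f z = bandlimited σ F z

/-- The Paley-Wiener space `PW¹_σ`. -/
def PaleyWiener1 (σ : ℝ) : Set (ℂ → ℂ) :=
  {f | ∃ F : ℝ → ℂ, IsSpectrum σ f F}

/-- The norm of `PW¹_σ`: the `L¹`-norm `(1 / 2σ) ∫_{-σ}^{σ} |F(ω)| dω` of the spectrum `F` of `f`,
on an interval of finite length normalized by that length. As `F` is unique almost everywhere,
the infimum is over a single number. -/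
def paleyWiener1Norm (σ : ℝ) (f : ℂ → ℂ) : ℝ :=
  sInf {r : ℝ | ∃ F : ℝ → ℂ, IsSpectrum σ f F ∧
    r = (1 / (2 * σ)) * ∫ ω in Set.Icc (-σ) σ, ‖F ω‖}

/-- Entire functions of exponential type at most `σ`. -/
def IsEntireOfExpType (σ : ℝ) (f : ℂ → ℂ) : Prop :=
  Differentiable ℂ f ∧
    ∀ ε : ℝ, 0 < ε → ∃ C : ℝ, ∀ z : ℂ, ‖f z‖ ≤ C * Real.exp ((σ + ε) * ‖z‖)

/-- Sine-type functions (of type `π`): entire of exponential type `π`, with simple and separated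
zeros, and comparable to `e^{π|η|}` for `|η| ≥ H`. -/
structure IsSineType (φ : ℂ → ℂ) : Prop where
  expType : IsEntireOfExpType Real.pi φ
  simple : ∀ z : ℂ, φ z = 0 → deriv φ z ≠ 0
  separated : ∃ δ : ℝ, 0 < δ ∧ ∀ z w : ℂ, φ z = 0 → φ w = 0 → z ≠ w → δ ≤ ‖z - w‖
  bounds : ∃ a b H : ℝ, 0 < a ∧ 0 < b ∧ 0 < H ∧ ∀ ξ η : ℝ, H ≤ |η| →
    a * Real.exp (Real.pi * |η|) ≤ ‖φ (ξ + η * Complex.I)‖ ∧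
      ‖φ (ξ + η * Complex.I)‖ ≤ b * Real.exp (Real.pi * |η|)

/-- The interpolation kernel `z ↦ φ(z) / (φ'(μ) (z - μ))` of a simple zero `μ` of `φ`, with the
removable singularity at `z = μ` filled in by the limit `1`. -/
def interpKernel (φ : ℂ → ℂ) (μ z : ℂ) : ℂ :=
  if z = μ then 1 else φ z / (deriv φ μ * (z - μ))

/-- The non-uniform sampling series `A_N f`. -/
def samplingSeries (φ : ℂ → ℂ) (Λ : ℤ → ℂ) (N : ℕ) (f : ℂ → ℂ) (z : ℂ) : ℂ :=
  ∑ n ∈ Finset.Icc (-(N : ℤ)) (N : ℤ), f (Λ n) * interpKernel φ (Λ n) z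

end

open Filter Topology MeasureTheory

noncomputable section

/-! ### Series of integrable functions and of band-limited functions -/

/-! The divergence comes from a resonance at the edge of the band, strong enough to survive
replacing the integers by the zeros of `φ`.

The test function is a sum over `j` of blocks with weight `2^(-j)`, the spectrum of the `j`-th block
being a ramp of bounded mass on `[π - ε_j, π]`, where `ε_j = 2^(-4^j)`. At an integer `k ≠ 0` the
factor `e^(iπk) = (-1)^k` comes out, and what remains of a block has real part `(1 - cos (ε_j k)) /
(ε_j k)^2`, which is nonnegative everywhere and at least `1/4` once `ε_j |k| ≤ 1`. Hence `(-1)^k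
f(k)` has real part at least `edgeWeight |k|` (`edgeWeight_le_re_testFun`). This weight decreases so
slowly that its product with `log |k|` tends to infinity (`tendsto_edgeWeight_mul_log`).

By the Riemann-Lebesgue lemma `g` and `g'` vanish at infinity in horizontal strips. So a zero `λ` of
large real part is close to an integer `k`, with `(-1)^k φ'(λ)` close to `Aπ`
(`exists_zeros_near_int`), and consecutive zeros far to the right belong to consecutive integers
(`exists_shift_of_zeros`). On such a neighbourhood of `k` the test function varies only by a small
multiple of `edgeWeight |k|` (`norm_testFun_sub_le`).

Now evaluate `A_N f` at the half-integer `t` just to the right of the integer belonging to `λ_N`;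
there `|φ(t)| ≥ A/2`. The alternating signs of `f(λ_n)` and `φ'(λ_n)` cancel, and `t` lies to the
right of every node, so outside a fixed finite set all terms have nonnegative real part after
division by `φ(t)` (`edgeWeight_le_re_term`). The nodes on the right contribute a harmonic sum times
the weight, which tends to infinity along all `N`; this is what makes the divergence strong. -/

theorem integrable_tsum_of_summable_integral_norm {α : Type*} [MeasurableSpace α] {μ : Measure α}
    {F : ℕ → α → ℂ} (hF : ∀ i, Integrable (F i) μ)
    (hs : Summable fun i => ∫ a, ‖F i a‖ ∂μ) :
    Integrable (fun a => ∑' i, F i a) μ := by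
  have h1 : ∑' i, ∫⁻ a, ‖F i a‖ₑ ∂μ ≠ ⊤ := by
    have (i : ℕ) : ∫⁻ a, ‖F i a‖ₑ ∂μ = ENNReal.ofReal (∫ a, ‖F i a‖ ∂μ) := by
      rw [ofReal_integral_norm_eq_lintegral_enorm (hF i)]
    simp_rw [this]
    exact hs.tsum_ofReal_ne_top
  have h2 : ∫⁻ a, ∑' i, ‖F i a‖ₑ ∂μ ≠ ⊤ := by
    rwa [lintegral_tsum fun i => (hF i).1.enorm]
  have h3 : ∀ᵐ a ∂μ, Summable fun i => F i a := by
    have := ae_lt_top' (AEMeasurable.tsum fun i => (hF i).1.enorm) h2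
    filter_upwards [this] with a ha
    refine Summable.of_norm ?_
    have h4 : ∑' i, ((‖F i a‖₊ : NNReal) : ENNReal) ≠ ⊤ := ha.ne
    exact NNReal.summable_coe.2 (ENNReal.tsum_coe_ne_top_iff_summable.1 h4)
  refine ⟨aestronglyMeasurable_of_tendsto_ae atTop
    (f := fun n a => ∑ i ∈ Finset.range n, F i a) (fun n => ?_) ?_, ?_⟩
  · exact (integrable_finsetSum (Finset.range n) fun i _ => hF i).1
  · filter_upwards [h3] with a ha using ha.hasSum.tendsto_sum_nat
  · exact lt_of_le_of_lt (lintegral_mono fun a => enorm_tsum_le_tsum_enorm) h2.lt_top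

theorem norm_exp_I_mul_le {σ ω : ℝ} (hω : ω ∈ Set.Icc (-σ) σ) (z : ℂ) :
    ‖Complex.exp (Complex.I * ω * z)‖ ≤ Real.exp (σ * |z.im|) := by
  rw [Complex.norm_exp]
  refine Real.exp_le_exp.2 ?_
  have : (Complex.I * ω * z).re = -(ω * z.im) := by simp
  rw [this]
  have h1 : |ω| ≤ σ := abs_le.2 ⟨hω.1, hω.2⟩
  calc -(ω * z.im) ≤ |ω * z.im| := neg_le_abs _
    _ = |ω| * |z.im| := abs_mul _ _
    _ ≤ _ := by gcongr

theorem integrableOn_mul_exp {σ : ℝ} {F : ℝ → ℂ} (hF : IntegrableOn F (Set.Icc (-σ) σ)) (z : ℂ) :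
    IntegrableOn (fun ω : ℝ => F ω * Complex.exp (Complex.I * ω * z)) (Set.Icc (-σ) σ) := by
  refine Integrable.mul_bdd (c := Real.exp (σ * |z.im|)) hF ?_ ?_
  · exact Continuous.aestronglyMeasurable (by fun_prop)
  · exact (ae_restrict_iff' measurableSet_Icc).2 (ae_of_all _ fun ω hω => norm_exp_I_mul_le hω z)

theorem hasSum_bandlimited {σ : ℝ} {F : ℕ → ℝ → ℂ} (hF : ∀ i, IntegrableOn (F i) (Set.Icc (-σ) σ))
    (hs : Summable fun i => ∫ ω in Set.Icc (-σ) σ, ‖F i ω‖) (z : ℂ) :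
    HasSum (fun i => bandlimited σ (F i) z) (bandlimited σ (fun ω => ∑' i, F i ω) z) := by
  unfold bandlimited
  refine HasSum.mul_left _ ?_
  have := hasSum_integral_of_summable_integral_norm (μ := volume.restrict (Set.Icc (-σ) σ))
    (F := fun i (ω : ℝ) => F i ω * Complex.exp (Complex.I * ω * z))
    (fun i => integrableOn_mul_exp (hF i) z) ?_
  · simpa only [tsum_mul_right] using this
  · refine Summable.of_nonneg_of_le (fun i => integral_nonneg fun _ => norm_nonneg _) (fun i => ?_)
      (hs.mul_right (Real.exp (σ * |z.im|)))
    rw [← integral_mul_const]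
    refine setIntegral_mono_on (integrableOn_mul_exp (hF i) z).norm ((hF i).norm.mul_const _)
      measurableSet_Icc fun ω hω => ?_
    rw [norm_mul]
    gcongr
    exact norm_exp_I_mul_le hω z

/-! ### The kernel whose spectrum is a triangle at the right end of the band -/

/-- The increasing ramp on `[π - ε, π]`, extended by zero to the left. -/
def edgeRamp (ε ω : ℝ) : ℝ := 2 * Real.pi / ε * max 0 (1 - (Real.pi - ω) / ε)

/-- The function with spectrum `edgeRamp ε`. -/
def edgeKernel (ε : ℝ) (z : ℂ) : ℂ := bandlimited Real.pi (fun ω => (edgeRamp ε ω : ℂ)) z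

theorem continuous_edgeRamp (ε : ℝ) : Continuous (edgeRamp ε) := by
  unfold edgeRamp; fun_prop

theorem edgeRamp_nonneg {ε : ℝ} (hε : 0 < ε) (ω : ℝ) : 0 ≤ edgeRamp ε ω :=
  mul_nonneg (by positivity) (le_max_left _ _)

theorem integrableOn_edgeRamp (ε : ℝ) :
    IntegrableOn (fun ω => (edgeRamp ε ω : ℂ)) (Set.Icc (-Real.pi) Real.pi) :=
  Continuous.integrableOn_Icc (Complex.continuous_ofReal.comp (continuous_edgeRamp ε))

theorem edgeKernel_eq_integral {ε : ℝ} (hε : 0 < ε) (hε1 : ε ≤ 1) (z : ℂ) :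
    edgeKernel ε z = ∫ ω in (Real.pi - ε)..Real.pi,
      ((1 / ε : ℝ) : ℂ) * (((1 - (Real.pi - ω) / ε : ℝ) : ℂ) * Complex.exp (Complex.I * ω * z)) := by
  have hpi := Real.pi_gt_three
  unfold edgeKernel bandlimited
  rw [integral_Icc_eq_integral_Ioc, ← intervalIntegral.integral_of_le (by linarith)]
  have hc : Continuous fun ω : ℝ => (edgeRamp ε ω : ℂ) * Complex.exp (Complex.I * ω * z) := by
    have := continuous_edgeRamp ε
    fun_prop
  rw [← intervalIntegral.integral_add_adjacent_intervals (b := Real.pi - ε)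
    (hc.intervalIntegrable _ _) (hc.intervalIntegrable _ _)]
  have h0 : ∫ ω in (-Real.pi)..(Real.pi - ε),
      (edgeRamp ε ω : ℂ) * Complex.exp (Complex.I * ω * z) = 0 := by
    rw [intervalIntegral.integral_congr (g := fun _ => (0 : ℂ))]
    · simp
    · intro ω hω
      rw [Set.uIcc_of_le (by linarith)] at hω
      have : 1 ≤ (Real.pi - ω) / ε := by
        rw [le_div_iff₀ hε]; linarith [hω.2]
      simp only [edgeRamp]
      rw [max_eq_left (by linarith)]
      simp
  rw [h0, zero_add, ← intervalIntegral.integral_const_mul]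
  refine intervalIntegral.integral_congr fun ω hω => ?_
  rw [Set.uIcc_of_le (by linarith)] at hω
  have : (Real.pi - ω) / ε ≤ 1 := by
    rw [div_le_iff₀ hε]; linarith [hω.1]
  simp only [edgeRamp]
  rw [max_eq_right (by linarith)]
  have hp : (Real.pi : ℂ) ≠ 0 := by exact_mod_cast Real.pi_ne_zero
  push_cast
  field_simp

theorem norm_edgeKernel_le {ε : ℝ} (hε : 0 < ε) (hε1 : ε ≤ 1) (z : ℂ) :
    ‖edgeKernel ε z‖ ≤ Real.exp (Real.pi * |z.im|) := by
  have hpi := Real.pi_gt_three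
  rw [edgeKernel_eq_integral hε hε1]
  refine (intervalIntegral.norm_integral_le_of_norm_le_const
    (C := 1 / ε * Real.exp (Real.pi * |z.im|)) fun ω hω => ?_).trans ?_
  · rw [Set.uIoc_of_le (by linarith)] at hω
    have h1 : (Real.pi - ω) / ε ≤ 1 := by
      rw [div_le_iff₀ hε]; linarith [hω.1]
    have h2 : 0 ≤ (Real.pi - ω) / ε := div_nonneg (by linarith [hω.2]) hε.le
    have h3 : ‖((1 - (Real.pi - ω) / ε : ℝ) : ℂ)‖ ≤ 1 := by
      rw [Complex.norm_real, Real.norm_eq_abs, abs_le]; constructor <;> linarith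
    have h4 : ‖((1 / ε : ℝ) : ℂ)‖ = 1 / ε := by
      rw [Complex.norm_real, Real.norm_eq_abs, abs_of_pos (by positivity)]
    rw [norm_mul, norm_mul, h4]
    have h5 := norm_exp_I_mul_le (σ := Real.pi) ⟨by linarith [hω.1], hω.2⟩ z
    gcongr
    calc _ ≤ 1 * Real.exp (Real.pi * |z.im|) := by gcongr
      _ = _ := one_mul _
  · rw [sub_sub_cancel, abs_of_pos hε]
    apply le_of_eq
    field_simp

/-- The spectrum is nonnegative, so its mass is `2π` times the value of the kernel at `0`, and the
pointwise bound applies there. -/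
theorem integral_norm_edgeRamp_le {ε : ℝ} (hε : 0 < ε) (hε1 : ε ≤ 1) :
    ∫ ω in Set.Icc (-Real.pi) Real.pi, ‖(edgeRamp ε ω : ℂ)‖ ≤ 2 * Real.pi := by
  have h := norm_edgeKernel_le hε hε1 0
  have hpi := Real.pi_pos
  unfold edgeKernel bandlimited at h
  simp only [mul_zero, Complex.exp_zero, mul_one, Complex.zero_im, abs_zero, Real.exp_zero] at h
  have h2 : ∫ ω in Set.Icc (-Real.pi) Real.pi, ‖(edgeRamp ε ω : ℂ)‖
      = ∫ ω in Set.Icc (-Real.pi) Real.pi, edgeRamp ε ω :=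
    integral_congr_ae (ae_of_all _ fun ω => by
      simp [abs_of_nonneg (edgeRamp_nonneg hε ω)])
  rw [integral_complex_ofReal, norm_mul, Complex.norm_real, Real.norm_eq_abs,
    abs_of_nonneg (integral_nonneg fun ω => edgeRamp_nonneg hε ω)] at h
  have h3 : ‖(1 / (2 * Real.pi) : ℂ)‖ = 1 / (2 * Real.pi) := by
    rw [← abs_of_pos (show 0 < 1 / (2 * Real.pi) by positivity), ← Real.norm_eq_abs,
      ← Complex.norm_real]
    push_cast; rfl
  rw [h3, div_mul_eq_mul_div, one_mul, div_le_one (by positivity)] at h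
  rwa [h2]

/-- Integration by parts, checked through an explicit antiderivative. All finer information about
the kernel (decay, values at integers, holomorphy off `0`) is read off from this formula. -/
theorem edgeKernel_eq {ε : ℝ} (hε : 0 < ε) (hε1 : ε ≤ 1) {z : ℂ} (hz : z ≠ 0) :
    edgeKernel ε z = Complex.exp (Real.pi * (Complex.I * z)) / (ε * (Complex.I * z))
      - (Complex.exp (Real.pi * (Complex.I * z)) - Complex.exp ((Real.pi - ε : ℝ) * (Complex.I * z)))
        / (ε * (Complex.I * z)) ^ 2 := by
  have hw : Complex.I * z ≠ 0 := mul_ne_zero Complex.I_ne_zero hz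
  have hεc : (ε : ℂ) ≠ 0 := by exact_mod_cast hε.ne'
  rw [edgeKernel_eq_integral hε hε1]
  set w := Complex.I * z with hwdef
  rw [intervalIntegral.integral_eq_sub_of_hasDerivAt (f := fun ω : ℝ =>
    (1 / ε : ℂ) * (((1 - (Real.pi - ω) / ε : ℂ)) * Complex.exp (ω * w) / w
      - Complex.exp (ω * w) / (ε * w ^ 2)))]
  · push_cast
    field_simp
    ring
  · intro ω _
    have he : HasDerivAt (fun ω : ℝ => Complex.exp (ω * w)) (Complex.exp (ω * w) * w) ω := by
      have := ((Complex.ofRealCLM.hasDerivAt (x := ω)).mul_const w).cexp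
      simpa using this
    have hl : HasDerivAt (fun ω : ℝ => (1 - (Real.pi - ω) / ε : ℂ)) (1 / ε : ℂ) ω := by
      have := (((Complex.ofRealCLM.hasDerivAt (x := ω)).const_sub (Real.pi : ℂ)).div_const
        (ε : ℂ)).const_sub 1
      simpa [neg_div] using this
    have := ((((hl.mul he).div_const w).sub (he.div_const (ε * w ^ 2))).const_mul (1 / ε : ℂ))
    refine this.congr_deriv ?_
    have : Complex.I * ω * z = ω * w := by rw [hwdef]; ring
    rw [this]
    push_cast
    field_simp
    ring
  · apply Continuous.intervalIntegrable
    fun_prop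

/-- Cauchy's estimate on circles of radius `1/2` bounds the derivative by `2 * C` on the half-size
ball; the mean value inequality does the rest. -/
theorem norm_sub_le_of_norm_le_closedBall {f : ℂ → ℂ} {c : ℂ} {C : ℝ}
    (hf : DifferentiableOn ℂ f (Metric.closedBall c 1))
    (hC : ∀ w ∈ Metric.closedBall c 1, ‖f w‖ ≤ C) {w : ℂ} (hw : ‖w - c‖ ≤ 1 / 2) :
    ‖f w - f c‖ ≤ 2 * C * ‖w - c‖ := by
  have hsub : ∀ v ∈ Metric.closedBall c (1 / 2), Metric.closedBall v (1 / 2) ⊆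
      Metric.closedBall c 1 := fun v hv =>
    Metric.closedBall_subset_closedBall' (by rw [Metric.mem_closedBall] at hv; linarith)
  refine Convex.norm_image_sub_le_of_norm_deriv_le (𝕜 := ℂ) (s := Metric.closedBall c (1 / 2))
    (fun v hv => ?_) (fun v hv => ?_) (convex_closedBall _ _)
    (Metric.mem_closedBall_self (by norm_num)) (by rwa [Metric.mem_closedBall, dist_eq_norm])
  · refine hf.differentiableAt (mem_of_superset ?_ (hsub v hv))
    exact Metric.closedBall_mem_nhds _ (by norm_num)
  · have := Complex.norm_deriv_le_of_forall_mem_sphere_norm_le (c := v) (R := 1 / 2) (C := C)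
      (by norm_num) ((hf.mono (hsub v hv)).diffContOnCl_ball subset_rfl)
      (fun u hu => hC u (hsub v hv (Metric.sphere_subset_closedBall hu)))
    linarith

theorem norm_edgeKernel_le_min {ε : ℝ} (hε : 0 < ε) (hε1 : ε ≤ 1) {z : ℂ} (hz : z ≠ 0) :
    ‖edgeKernel ε z‖ ≤ 3 * Real.exp (Real.pi * |z.im|) * min 1 (1 / (ε * ‖z‖)) := by
  have hpi := Real.pi_gt_three
  have hzn : 0 < ‖z‖ := norm_pos_iff.2 hz
  have hE := Real.exp_pos (Real.pi * |z.im|)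
  rcases le_total (ε * ‖z‖) 1 with h | h
  · rw [min_eq_left (by rw [le_div_iff₀ (by positivity)]; linarith)]
    linarith [norm_edgeKernel_le hε hε1 z]
  · rw [min_eq_right (by rw [div_le_one (by positivity)]; exact h), edgeKernel_eq hε hε1 hz]
    have e1 : ‖Complex.exp (Real.pi * (Complex.I * z))‖ ≤ Real.exp (Real.pi * |z.im|) := by
      have := norm_exp_I_mul_le (σ := Real.pi) (ω := Real.pi) ⟨by linarith, le_rfl⟩ z
      rwa [show Complex.I * (Real.pi : ℂ) * z = Real.pi * (Complex.I * z) by ring] at this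
    have e2 : ‖Complex.exp ((Real.pi - ε : ℝ) * (Complex.I * z))‖
        ≤ Real.exp (Real.pi * |z.im|) := by
      have := norm_exp_I_mul_le (σ := Real.pi) (ω := Real.pi - ε) ⟨by linarith, by linarith⟩ z
      rwa [show Complex.I * ((Real.pi - ε : ℝ) : ℂ) * z
        = ((Real.pi - ε : ℝ) : ℂ) * (Complex.I * z) by ring] at this
    have e3 : ‖(ε : ℂ) * (Complex.I * z)‖ = ε * ‖z‖ := by
      simp [abs_of_pos hε]
    refine (norm_sub_le _ _).trans ?_
    rw [norm_div, norm_div, norm_pow, e3]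
    have e4 : ‖Complex.exp (Real.pi * (Complex.I * z)) -
        Complex.exp ((Real.pi - ε : ℝ) * (Complex.I * z))‖ ≤ 2 * Real.exp (Real.pi * |z.im|) :=
      (norm_sub_le _ _).trans (by linarith)
    have hp : 0 < ε * ‖z‖ := by positivity
    have e5 : (2 * Real.exp (Real.pi * |z.im|)) / (ε * ‖z‖) ^ 2
        ≤ (2 * Real.exp (Real.pi * |z.im|)) / (ε * ‖z‖) := by
      apply div_le_div_of_nonneg_left (by positivity) hp
      nlinarith
    calc _ ≤ Real.exp (Real.pi * |z.im|) / (ε * ‖z‖)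
          + (2 * Real.exp (Real.pi * |z.im|)) / (ε * ‖z‖) ^ 2 := by gcongr
      _ ≤ Real.exp (Real.pi * |z.im|) / (ε * ‖z‖)
          + (2 * Real.exp (Real.pi * |z.im|)) / (ε * ‖z‖) := by gcongr
      _ = _ := by ring

theorem exp_pi_mul_I_mul_int (k : ℤ) : Complex.exp (Real.pi * (Complex.I * k)) = (-1) ^ k := by
  rw [show (Real.pi : ℂ) * (Complex.I * k) = k * (Real.pi * Complex.I) by ring,
    Complex.exp_int_mul, Complex.exp_pi_mul_I]

theorem neg_one_zpow_mul_self (k : ℤ) : (-1 : ℂ) ^ k * (-1) ^ k = 1 := by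
  rw [← mul_zpow]; simp

theorem norm_neg_one_zpow (k : ℤ) : ‖(-1 : ℂ) ^ k‖ = 1 := by
  rw [norm_zpow]; simp

/-- Since `e^(iπk) = (-1)^k`, the first term of the closed form becomes purely imaginary and the
second leaves a Fejér-type nonnegative quotient. -/
theorem re_edgeKernel_int {ε : ℝ} (hε : 0 < ε) (hε1 : ε ≤ 1) {k : ℤ} (hk : k ≠ 0) :
    ((-1) ^ k * edgeKernel ε k).re = (1 - Real.cos (ε * k)) / (ε * k) ^ 2 := by
  have hkc : (k : ℂ) ≠ 0 := by exact_mod_cast hk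
  have hεc : (ε : ℂ) ≠ 0 := by exact_mod_cast hε.ne'
  rw [edgeKernel_eq hε hε1 hkc]
  have h2 : Complex.exp ((Real.pi - ε : ℝ) * (Complex.I * k))
      = (-1) ^ k * Complex.exp (((-(ε * k) : ℝ) : ℂ) * Complex.I) := by
    rw [← exp_pi_mul_I_mul_int, ← Complex.exp_add]
    congr 1
    push_cast; ring
  rw [h2, exp_pi_mul_I_mul_int]
  have h3 : (-1 : ℂ) ^ k * ((-1) ^ k / (ε * (Complex.I * k))
      - ((-1) ^ k - (-1) ^ k * Complex.exp (((-(ε * k) : ℝ) : ℂ) * Complex.I))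
        / (ε * (Complex.I * k)) ^ 2)
      = ((-1 / (ε * k) : ℝ) : ℂ) * Complex.I
        + ((1 / (ε * k) ^ 2 : ℝ) : ℂ)
          * (1 - Complex.exp (((-(ε * k) : ℝ) : ℂ) * Complex.I)) := by
    set x := Complex.exp (((-(ε * k) : ℝ) : ℂ) * Complex.I)
    have h4 := neg_one_zpow_mul_self k
    have hI := Complex.I_sq
    calc _ = ((-1 : ℂ) ^ k * (-1) ^ k) * (1 / (ε * (Complex.I * k)) - (1 - x)
          / (ε * (Complex.I * k)) ^ 2) := by ring
      _ = _ := by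
        rw [h4, mul_pow, mul_pow, hI]
        push_cast
        field_simp
        linear_combination ((ε : ℂ) * k) * hI
  rw [h3, Complex.add_re, Complex.re_ofReal_mul, Complex.re_ofReal_mul, Complex.sub_re,
    Complex.exp_ofReal_mul_I_re, Real.cos_neg]
  simp
  ring

theorem re_edgeKernel_int_nonneg {ε : ℝ} (hε : 0 < ε) (hε1 : ε ≤ 1) {k : ℤ} (hk : k ≠ 0) :
    0 ≤ ((-1) ^ k * edgeKernel ε k).re := by
  rw [re_edgeKernel_int hε hε1 hk]
  exact div_nonneg (by linarith [Real.cos_le_one (ε * k)]) (sq_nonneg _)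

theorem le_re_edgeKernel_int {ε : ℝ} (hε : 0 < ε) (hε1 : ε ≤ 1) {k : ℤ} (hk : k ≠ 0)
    (h : ε * |(k : ℝ)| ≤ 1) : 1 / 4 ≤ ((-1) ^ k * edgeKernel ε k).re := by
  rw [re_edgeKernel_int hε hε1 hk]
  set x : ℝ := ε * k with hx
  have hx1 : |x| ≤ 1 := by rw [hx, abs_mul, abs_of_pos hε]; exact h
  have hx0 : x ≠ 0 := mul_ne_zero hε.ne' (by exact_mod_cast hk)
  have hb := (abs_le.1 (Real.cos_bound hx1)).2
  rw [le_div_iff₀ (by positivity)]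
  have hx2 : x ^ 2 ≤ 1 := (sq_le_one_iff_abs_le_one x).2 hx1
  have hx4 : |x| ^ 4 = x ^ 2 * x ^ 2 := by
    rw [show |x| ^ 4 = (|x| ^ 2) ^ 2 by ring, sq_abs]; ring
  rw [hx4] at hb
  nlinarith [sq_nonneg x]

theorem differentiableOn_edgeKernel {ε : ℝ} (hε : 0 < ε) (hε1 : ε ≤ 1) :
    DifferentiableOn ℂ (edgeKernel ε) {0}ᶜ := by
  refine DifferentiableOn.congr (f := fun z => Complex.exp (Real.pi * (Complex.I * z))
      / (ε * (Complex.I * z)) - (Complex.exp (Real.pi * (Complex.I * z))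
      - Complex.exp ((Real.pi - ε : ℝ) * (Complex.I * z))) / (ε * (Complex.I * z)) ^ 2)
    (fun z hz => ?_) (fun z hz => edgeKernel_eq hε hε1 hz)
  have h : (ε : ℂ) * (Complex.I * z) ≠ 0 :=
    mul_ne_zero (by exact_mod_cast hε.ne') (mul_ne_zero Complex.I_ne_zero hz)
  refine DifferentiableAt.differentiableWithinAt ?_
  refine DifferentiableAt.fun_sub ?_ ?_
  · exact DifferentiableAt.fun_div (by fun_prop) (by fun_prop) h
  · exact DifferentiableAt.fun_div (by fun_prop) (by fun_prop) (pow_ne_zero 2 h)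

theorem norm_edgeKernel_le_of_near_int {ε : ℝ} (hε : 0 < ε) (hε1 : ε ≤ 1) {k : ℤ}
    (hk : 2 ≤ |(k : ℝ)|) {w : ℂ} (hw : ‖w - k‖ ≤ 1) :
    ‖edgeKernel ε w‖ ≤ 6 * Real.exp Real.pi * min 1 (1 / (ε * |(k : ℝ)|)) := by
  have hkn : ‖(k : ℂ)‖ = |(k : ℝ)| := by simp
  have h1 : |(k : ℝ)| / 2 ≤ ‖w‖ := by
    have := norm_sub_norm_le (k : ℂ) w
    rw [norm_sub_rev, hkn] at this
    linarith
  have hw0 : w ≠ 0 := norm_pos_iff.1 (by linarith)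
  have him : |w.im| ≤ 1 := by
    have := Complex.abs_im_le_norm (w - k)
    simp at this
    linarith
  refine (norm_edgeKernel_le_min hε hε1 hw0).trans ?_
  have e1 : Real.exp (Real.pi * |w.im|) ≤ Real.exp Real.pi :=
    Real.exp_le_exp.2 (by nlinarith [Real.pi_pos])
  have e2 : min 1 (1 / (ε * ‖w‖)) ≤ 2 * min 1 (1 / (ε * |(k : ℝ)|)) := by
    rw [mul_min_of_nonneg _ _ (by norm_num : (0 : ℝ) ≤ 2)]
    refine le_min ((min_le_left _ _).trans (by norm_num)) ((min_le_right _ _).trans ?_)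
    rw [show 2 * (1 / (ε * |(k : ℝ)|)) = 1 / (ε * (|(k : ℝ)| / 2)) by
      field_simp]
    exact one_div_le_one_div_of_le (mul_pos hε (by linarith)) (by gcongr)
  have e3 : 0 ≤ min 1 (1 / (ε * ‖w‖)) := by positivity
  calc _ ≤ 3 * Real.exp Real.pi * (2 * min 1 (1 / (ε * |(k : ℝ)|))) := by gcongr
    _ = _ := by ring

theorem norm_edgeKernel_sub_le {ε : ℝ} (hε : 0 < ε) (hε1 : ε ≤ 1) {k : ℤ}
    (hk : 2 ≤ |(k : ℝ)|) {w : ℂ} (hw : ‖w - k‖ ≤ 1 / 2) :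
    ‖edgeKernel ε w - edgeKernel ε k‖
      ≤ 2 * (6 * Real.exp Real.pi * min 1 (1 / (ε * |(k : ℝ)|))) * ‖w - k‖ := by
  refine norm_sub_le_of_norm_le_closedBall ((differentiableOn_edgeKernel hε hε1).mono ?_)
    (fun v hv => norm_edgeKernel_le_of_near_int hε hε1 hk ?_) hw
  · intro v hv h0
    rw [Set.mem_singleton_iff.1 h0, Metric.mem_closedBall, dist_eq_norm, zero_sub, norm_neg] at hv
    have : ‖(k : ℂ)‖ = |(k : ℝ)| := by simp
    linarith
  · rwa [Metric.mem_closedBall, dist_eq_norm] at hv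

/-! ### The test function -/

/-- The widths of the spectra of the building blocks. -/
def edgeWidth (j : ℕ) : ℝ := ((2 : ℝ) ^ (4 ^ j))⁻¹

theorem edgeWidth_pos (j : ℕ) : 0 < edgeWidth j := by unfold edgeWidth; positivity

theorem edgeWidth_le_one (j : ℕ) : edgeWidth j ≤ 1 :=
  inv_le_one_of_one_le₀ (one_le_pow₀ (by norm_num))

/-- The spectrum of the test function. -/
def testSpectrum (ω : ℝ) : ℂ := ∑' j : ℕ, (1 / 2 : ℂ) ^ j * (edgeRamp (edgeWidth j) ω : ℂ)

/-- The test function: its values at large integers `k` are of size `edgeWeight |k|`,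
with alternating signs. -/
def testFun (z : ℂ) : ℂ := bandlimited Real.pi testSpectrum z

/-- A slowly decaying minorant for the absolute values of the test function on the integers. -/
def edgeWeight (n : ℕ) : ℝ := (1 / 2) ^ (Nat.clog 4 (Nat.clog 2 n)) / 2

theorem summable_integral_norm_blocks :
    Summable fun j : ℕ => ∫ ω in Set.Icc (-Real.pi) Real.pi,
      ‖(1 / 2 : ℂ) ^ j * (edgeRamp (edgeWidth j) ω : ℂ)‖ := by
  refine Summable.of_nonneg_of_le (fun i => integral_nonneg fun _ => norm_nonneg _) (fun j => ?_)
    (summable_geometric_two.mul_right (2 * Real.pi))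
  simp_rw [norm_mul, norm_pow]
  rw [integral_const_mul]
  have : ‖(1 / 2 : ℂ)‖ = 1 / 2 := by norm_num
  rw [this]
  gcongr
  exact integral_norm_edgeRamp_le (edgeWidth_pos j) (edgeWidth_le_one j)

theorem testFun_mem : testFun ∈ PaleyWiener1 Real.pi :=
  ⟨testSpectrum, integrable_tsum_of_summable_integral_norm
    (fun _ => (integrableOn_edgeRamp _).const_mul _) summable_integral_norm_blocks, fun _ => rfl⟩

theorem hasSum_testFun (z : ℂ) :
    HasSum (fun j : ℕ => (1 / 2 : ℂ) ^ j * edgeKernel (edgeWidth j) z) (testFun z) := by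
  have := hasSum_bandlimited (σ := Real.pi)
    (F := fun j ω => (1 / 2 : ℂ) ^ j * (edgeRamp (edgeWidth j) ω : ℂ))
    (fun _ => (integrableOn_edgeRamp _).const_mul _) summable_integral_norm_blocks z
  change HasSum _ (testFun z) at this
  convert this using 2 with j
  unfold edgeKernel bandlimited
  simp_rw [mul_assoc]
  rw [integral_const_mul]
  ring

theorem edgeWeight_pos (n : ℕ) : 0 < edgeWeight n := by unfold edgeWeight; positivity

theorem edgeWeight_antitone : Antitone edgeWeight := fun a b h => by
  unfold edgeWeight
  have h1 : Nat.clog 4 (Nat.clog 2 a) ≤ Nat.clog 4 (Nat.clog 2 b) :=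
    Nat.clog_mono_right _ (Nat.clog_mono_right _ h)
  have := pow_le_pow_of_le_one (a := (1 / 2 : ℝ)) (by norm_num) (by norm_num) h1
  linarith

/-- The iterated `Nat.clog` is thus the index of the first block with `edgeWidth j * n ≤ 1`, that
is, the first one not yet decaying at `n`. -/
theorem clog_clog_le_iff (n j : ℕ) : Nat.clog 4 (Nat.clog 2 n) ≤ j ↔ n ≤ 2 ^ 4 ^ j := by
  rw [Nat.clog_le_iff_le_pow (by norm_num), Nat.clog_le_iff_le_pow (by norm_num)]

theorem one_le_clog_clog {n : ℕ} (hn : 3 ≤ n) : 1 ≤ Nat.clog 4 (Nat.clog 2 n) := by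
  by_contra! h
  have := (clog_clog_le_iff n 0).1 (by omega)
  norm_num at this
  omega

/-- The widths are tuned for this: if `p + 1` is the first index with `n ≤ 2 ^ 4 ^ (p + 1)`, then
`log n` exceeds `4 ^ p * log 2`, while the weight has only dropped to `2 ^ (-p) / 4`. -/
theorem log_le_mul_edgeWeight {n : ℕ} (hn : 3 ≤ n) :
    (2 : ℝ) ^ Nat.clog 4 (Nat.clog 2 n) * (Real.log 2 / 8) ≤ edgeWeight n * Real.log n := by
  obtain ⟨p, hp⟩ : ∃ p, Nat.clog 4 (Nat.clog 2 n) = p + 1 :=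
    ⟨_, (Nat.sub_add_cancel (one_le_clog_clog hn)).symm⟩
  have h1 : 2 ^ 4 ^ p < n := by
    by_contra! h
    have := (clog_clog_le_iff n p).2 h
    omega
  have h2 : (4 : ℝ) ^ p * Real.log 2 ≤ Real.log n := by
    have : ((2 : ℝ) ^ 4 ^ p) ≤ n := by exact_mod_cast h1.le
    have := Real.log_le_log (by positivity) this
    rw [Real.log_pow] at this
    exact_mod_cast this
  unfold edgeWeight
  rw [hp]
  calc (2 : ℝ) ^ (p + 1) * (Real.log 2 / 8)
      = (1 / 2) ^ (p + 1) / 2 * (4 ^ p * Real.log 2) := by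
        rw [show (4 : ℝ) ^ p = 2 ^ p * 2 ^ p by rw [← mul_pow]; norm_num, one_div, inv_pow, pow_succ]
        field_simp
        norm_num
    _ ≤ _ := by gcongr

theorem tendsto_edgeWeight_mul_log :
    Tendsto (fun n : ℕ => edgeWeight n * Real.log n) atTop atTop := by
  have h1 : Tendsto (fun n : ℕ => Nat.clog 4 (Nat.clog 2 n)) atTop atTop := by
    refine tendsto_atTop.2 fun b => ?_
    filter_upwards [eventually_gt_atTop (2 ^ 4 ^ b)] with n hn
    by_contra! h
    exact absurd ((clog_clog_le_iff n b).1 h.le) (by omega)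
  have h2 : Tendsto (fun n : ℕ => (2 : ℝ) ^ Nat.clog 4 (Nat.clog 2 n) * (Real.log 2 / 8))
      atTop atTop :=
    ((tendsto_pow_atTop_atTop_of_one_lt (by norm_num : (1 : ℝ) < 2)).comp h1).atTop_mul_const
      (div_pos (Real.log_pos (by norm_num)) (by norm_num))
  refine tendsto_atTop_mono' _ ?_ h2
  filter_upwards [eventually_ge_atTop 3] with n hn using log_le_mul_edgeWeight hn

/-- The size of the `j`-th building block at `n`. -/
def blockSize (n j : ℕ) : ℝ := min 1 (1 / (edgeWidth j * n))

theorem blockSize_nonneg (n j : ℕ) : 0 ≤ blockSize n j := by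
  have := edgeWidth_pos j
  unfold blockSize; positivity

theorem summable_blockSize (n : ℕ) : Summable fun j : ℕ => (1 / 2 : ℝ) ^ j * blockSize n j :=
  Summable.of_nonneg_of_le (fun j => mul_nonneg (by positivity) (blockSize_nonneg n j))
    (fun _ => mul_le_of_le_one_right (by positivity) (min_le_left _ _)) summable_geometric_two

/-- The upper counterpart of the minorant: the lacunary widths make every block before index `p`
smaller than `2 ^ (-p)` at `n`, and the blocks from `p` on form a geometric tail. Each part is at
most `2 * 2 ^ (-p)`, and the weight is `2 ^ (-p) / 4`. -/
theorem tsum_blockSize_le {n : ℕ} (hn : 3 ≤ n) :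
    ∑' j : ℕ, (1 / 2 : ℝ) ^ j * blockSize n j ≤ 16 * edgeWeight n := by
  obtain ⟨p, hp⟩ : ∃ p, Nat.clog 4 (Nat.clog 2 n) = p + 1 :=
    ⟨_, (Nat.sub_add_cancel (one_le_clog_clog hn)).symm⟩
  have h1 : 2 ^ 4 ^ p < n := by
    by_contra! h
    have := (clog_clog_le_iff n p).2 h
    omega
  have hsmall : ∀ j ∈ Finset.range p, (1 / 2 : ℝ) ^ j * blockSize n j
      ≤ (1 / 2 : ℝ) ^ j * (1 / 2) ^ p := by
    intro j hj
    rw [Finset.mem_range] at hj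
    gcongr
    refine (min_le_right _ _).trans ?_
    -- This leaves a spare factor `2 ^ p` between `2 ^ 4 ^ j` and `n`.
    have h3 : 4 ^ j + p ≤ 4 ^ p := by
      obtain ⟨q, rfl⟩ : ∃ q, p = q + 1 := ⟨p - 1, by omega⟩
      have e1 : 4 ^ j ≤ 4 ^ q := Nat.pow_le_pow_right (by norm_num) (by omega)
      have e2 : q < 4 ^ q := Nat.lt_pow_self (by norm_num)
      rw [pow_succ]
      omega
    have h4 : (2 : ℝ) ^ 4 ^ j * 2 ^ p ≤ n := by
      rw [← pow_add]
      calc (2 : ℝ) ^ (4 ^ j + p) ≤ 2 ^ (4 ^ p) := pow_le_pow_right₀ (by norm_num) h3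
        _ ≤ n := by exact_mod_cast h1.le
    unfold edgeWidth
    rw [one_div_pow]
    have hn0 : (0 : ℝ) < n := by exact_mod_cast (by omega : 0 < n)
    apply one_div_le_one_div_of_le (by positivity)
    rw [inv_mul_eq_div, le_div_iff₀ (by positivity)]
    linarith
  rw [← (summable_blockSize n).sum_add_tsum_nat_add p]
  have hA : ∑ j ∈ Finset.range p, (1 / 2 : ℝ) ^ j * blockSize n j ≤ 2 * (1 / 2) ^ p := by
    refine (Finset.sum_le_sum hsmall).trans ?_
    rw [← Finset.sum_mul]
    gcongr
    exact (summable_geometric_two.sum_le_tsum _ (fun _ _ => by positivity)).trans_eq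
      tsum_geometric_two
  have hB : ∑' j : ℕ, (1 / 2 : ℝ) ^ (j + p) * blockSize n (j + p) ≤ 2 * (1 / 2) ^ p := by
    have h2 : ∑' j : ℕ, (1 / 2 : ℝ) ^ j * (1 / 2) ^ p = 2 * (1 / 2) ^ p := by
      rw [tsum_mul_right, tsum_geometric_two]
    rw [← h2]
    refine Summable.tsum_le_tsum (fun j => ?_) ((summable_nat_add_iff p).2 (summable_blockSize n))
      (summable_geometric_two.mul_right _)
    rw [← pow_add]
    exact mul_le_of_le_one_right (by positivity) (min_le_left _ _)
  have : edgeWeight n = (1 / 2) ^ p / 4 := by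
    unfold edgeWeight
    rw [hp, pow_succ]; ring
  rw [this]
  linarith

theorem edgeWidth_mul_abs_le_one {k : ℤ} {j : ℕ} (h : Nat.clog 4 (Nat.clog 2 k.natAbs) ≤ j) :
    edgeWidth j * |(k : ℝ)| ≤ 1 := by
  have h2 : (k.natAbs : ℝ) ≤ ((2 ^ 4 ^ j : ℕ) : ℝ) :=
    Nat.cast_le.2 ((clog_clog_le_iff k.natAbs j).1 h)
  unfold edgeWidth
  rw [inv_mul_le_iff₀ (by positivity), mul_one, ← Int.cast_abs, ← Int.natCast_natAbs,
    Int.cast_natCast]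
  rwa [Nat.cast_pow, Nat.cast_ofNat] at h2

/-- No block contributes negatively, so the decayed ones can be dropped; those from index `m` on
give at least `1/4` each, and `2^(-j)/4` summed over `j ≥ m` is exactly the weight. -/
theorem edgeWeight_le_re_testFun {k : ℤ} (hk : k ≠ 0) :
    edgeWeight k.natAbs ≤ ((-1) ^ k * testFun k).re := by
  have hs : HasSum (fun j : ℕ => (1 / 2 : ℝ) ^ j * ((-1) ^ k * edgeKernel (edgeWidth j) k).re)
      (((-1) ^ k * testFun k).re) := by
    have := Complex.hasSum_re ((hasSum_testFun k).mul_left ((-1) ^ k))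
    have he : (fun j : ℕ => (1 / 2 : ℝ) ^ j * ((-1) ^ k * edgeKernel (edgeWidth j) k).re)
        = fun j : ℕ => ((-1) ^ k * ((1 / 2 : ℂ) ^ j * edgeKernel (edgeWidth j) k)).re := by
      funext j
      rw [← Complex.re_ofReal_mul]
      push_cast
      rw [mul_left_comm]
    rw [he]
    exact this
  rw [← hs.tsum_eq]
  obtain ⟨m, hm⟩ : ∃ m, m = Nat.clog 4 (Nat.clog 2 k.natAbs) := ⟨_, rfl⟩
  rw [← hs.summable.sum_add_tsum_nat_add m]
  have h0 : ∀ j, 0 ≤ (1 / 2 : ℝ) ^ j * ((-1) ^ k * edgeKernel (edgeWidth j) k).re := fun j =>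
    mul_nonneg (by positivity) (re_edgeKernel_int_nonneg (edgeWidth_pos j) (edgeWidth_le_one j) hk)
  have h1 : edgeWeight k.natAbs = ∑' j : ℕ, (1 / 2 : ℝ) ^ j * ((1 / 2) ^ m / 4) := by
    rw [tsum_mul_right, tsum_geometric_two]
    unfold edgeWeight
    rw [← hm]; ring
  rw [h1]
  have hle : ∀ j : ℕ, (1 / 2 : ℝ) ^ j * ((1 / 2) ^ m / 4)
      ≤ (1 / 2 : ℝ) ^ (j + m) * ((-1) ^ k * edgeKernel (edgeWidth (j + m)) k).re := by
    intro j
    have h3 : edgeWidth (j + m) * |(k : ℝ)| ≤ 1 :=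
      edgeWidth_mul_abs_le_one (hm ▸ Nat.le_add_left m j)
    have h4 := le_re_edgeKernel_int (edgeWidth_pos (j + m)) (edgeWidth_le_one (j + m)) hk h3
    calc (1 / 2 : ℝ) ^ j * ((1 / 2) ^ m / 4) = (1 / 2 : ℝ) ^ (j + m) * (1 / 4) := by
          rw [pow_add]; ring
      _ ≤ _ := mul_le_mul_of_nonneg_left h4 (by positivity)
  have hsum := Summable.tsum_le_tsum hle (summable_geometric_two.mul_right _)
    ((summable_nat_add_iff m).2 hs.summable)
  have hfin : 0 ≤ ∑ j ∈ Finset.range m,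
      (1 / 2 : ℝ) ^ j * ((-1) ^ k * edgeKernel (edgeWidth j) k).re :=
    Finset.sum_nonneg fun j _ => h0 j
  linarith

/-- The error has to be relative to `edgeWeight`: the values at integers may tend to zero, so an
absolute Lipschitz bound could not preserve their sign. The constant is `12 * 16`, from the block
estimate and `tsum_blockSize_le`. -/
theorem norm_testFun_sub_le {k : ℤ} (hk : 3 ≤ k.natAbs) {w : ℂ} (hw : ‖w - k‖ ≤ 1 / 2) :
    ‖testFun w - testFun k‖ ≤ 192 * Real.exp Real.pi * edgeWeight k.natAbs * ‖w - k‖ := by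
  have hkabs : |(k : ℝ)| = (k.natAbs : ℝ) := by
    rw [← Int.cast_abs, ← Int.natCast_natAbs]; rfl
  have hk2 : 2 ≤ |(k : ℝ)| := by
    rw [hkabs]; exact_mod_cast (by omega : 2 ≤ k.natAbs)
  have hs := (hasSum_testFun w).sub (hasSum_testFun k)
  have hb : ∀ j : ℕ, ‖(1 / 2 : ℂ) ^ j * edgeKernel (edgeWidth j) w
      - (1 / 2 : ℂ) ^ j * edgeKernel (edgeWidth j) k‖
      ≤ 12 * Real.exp Real.pi * ‖w - k‖ * ((1 / 2) ^ j * blockSize k.natAbs j) := by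
    intro j
    have := norm_edgeKernel_sub_le (edgeWidth_pos j) (edgeWidth_le_one j) hk2 hw
    rw [← mul_sub, norm_mul, norm_pow, show ‖(1 / 2 : ℂ)‖ = 1 / 2 by norm_num]
    unfold blockSize
    rw [hkabs] at this
    calc _ ≤ (1 / 2 : ℝ) ^ j * _ := mul_le_mul_of_nonneg_left this (by positivity)
      _ = _ := by ring
  have hsum := (summable_blockSize k.natAbs).mul_left (12 * Real.exp Real.pi * ‖w - k‖)
  rw [← hs.tsum_eq]
  refine (tsum_of_norm_bounded hsum.hasSum hb).trans ?_
  rw [tsum_mul_left]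
  calc _ ≤ 12 * Real.exp Real.pi * ‖w - k‖ * (16 * edgeWeight k.natAbs) := by
        gcongr; exact tsum_blockSize_le hk
    _ = _ := by ring

theorem norm_testFun_int_le {k : ℤ} (hk : 3 ≤ k.natAbs) :
    ‖testFun k‖ ≤ 96 * Real.exp Real.pi * edgeWeight k.natAbs := by
  have hkabs : |(k : ℝ)| = (k.natAbs : ℝ) := by
    rw [← Int.cast_abs, ← Int.natCast_natAbs]; rfl
  have hk2 : 2 ≤ |(k : ℝ)| := by
    rw [hkabs]; exact_mod_cast (by omega : 2 ≤ k.natAbs)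
  have hb : ∀ j : ℕ, ‖(1 / 2 : ℂ) ^ j * edgeKernel (edgeWidth j) k‖
      ≤ 6 * Real.exp Real.pi * ((1 / 2) ^ j * blockSize k.natAbs j) := by
    intro j
    have := norm_edgeKernel_le_of_near_int (edgeWidth_pos j) (edgeWidth_le_one j) hk2
      (w := (k : ℂ)) (by simp)
    rw [norm_mul, norm_pow, show ‖(1 / 2 : ℂ)‖ = 1 / 2 by norm_num]
    unfold blockSize
    rw [hkabs] at this
    calc _ ≤ (1 / 2 : ℝ) ^ j * _ := mul_le_mul_of_nonneg_left this (by positivity)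
      _ = _ := by ring
  have hsum := (summable_blockSize k.natAbs).mul_left (6 * Real.exp Real.pi)
  rw [← (hasSum_testFun k).tsum_eq]
  refine (tsum_of_norm_bounded hsum.hasSum hb).trans ?_
  rw [tsum_mul_left]
  calc _ ≤ 6 * Real.exp Real.pi * (16 * edgeWeight k.natAbs) := by
        gcongr; exact tsum_blockSize_le hk
    _ = _ := by ring

/-! ### Decay in horizontal strips -/

/-- `g (ξ + iη) → 0` as `|ξ| → ∞`, uniformly for `η` in bounded sets. -/
def VanishesInStrips (g : ℂ → ℂ) : Prop :=
  ∀ H ε : ℝ, 0 < ε → ∃ R : ℝ, ∀ z : ℂ, R ≤ |z.re| → |z.im| ≤ H → ‖g z‖ < ε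

/-- Riemann-Lebesgue for `F(ω) e^(-ωη)` cut off to the band; the variable is rescaled by `-1/(2π)`
to match the normalization of the Fourier character. -/
theorem tendsto_bandlimited_horizontal (σ : ℝ) (F : ℝ → ℂ) (η : ℝ) :
    Tendsto (fun ξ : ℝ => bandlimited σ F (ξ + η * Complex.I)) (cocompact ℝ) (𝓝 0) := by
  have h1 := Real.tendsto_integral_exp_smul_cocompact
    ((Set.Icc (-σ) σ).indicator fun ω => F ω * Complex.exp (-(ω * η)))
  have h2 : Tendsto (fun ξ : ℝ => ξ * (-(1 / (2 * Real.pi)))) (cocompact ℝ) (cocompact ℝ) :=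
    (Homeomorph.mulRight₀ (-(1 / (2 * Real.pi))) (by
      have := Real.pi_pos
      simp)).isClosedEmbedding.tendsto_cocompact
  have h3 := (h1.comp h2).const_mul (1 / (2 * Real.pi) : ℂ)
  rw [mul_zero] at h3
  refine h3.congr fun ξ => ?_
  unfold bandlimited
  rw [← integral_indicator measurableSet_Icc]
  congr 1
  refine integral_congr_ae (ae_of_all _ fun ω => ?_)
  by_cases hω : ω ∈ Set.Icc (-σ) σ
  · simp only [Set.indicator_of_mem hω]
    rw [Real.fourierChar_apply', Circle.smul_def, Circle.coe_exp, smul_eq_mul, mul_left_comm,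
      ← Complex.exp_add]
    congr 2
    have hp : (Real.pi : ℂ) ≠ 0 := by exact_mod_cast Real.pi_ne_zero
    push_cast
    field_simp
    ring_nf
    rw [Complex.I_sq]
    ring
  · simp [Set.indicator_of_notMem hω]

theorem norm_bandlimited_le {σ : ℝ} (hσ : 0 ≤ σ) {F : ℝ → ℂ}
    (hF : IntegrableOn F (Set.Icc (-σ) σ)) {H : ℝ} {z : ℂ} (hz : |z.im| ≤ H) :
    ‖bandlimited σ F z‖ ≤ (∫ ω in Set.Icc (-σ) σ, ‖F ω‖) * Real.exp (σ * H) := by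
  unfold bandlimited
  have hc : ‖(1 / (2 * Real.pi) : ℂ)‖ ≤ 1 := by
    have hp := Real.pi_gt_three
    rw [norm_div, norm_one, norm_mul, Complex.norm_real, Real.norm_eq_abs, abs_of_pos Real.pi_pos,
      div_le_one (by norm_num; exact Real.pi_pos)]
    norm_num
    linarith
  rw [norm_mul]
  refine (mul_le_of_le_one_left (norm_nonneg _) hc).trans ?_
  refine (norm_integral_le_integral_norm _).trans ?_
  rw [← integral_mul_const]
  refine setIntegral_mono_on (integrableOn_mul_exp hF z).norm (hF.norm.mul_const _)
    measurableSet_Icc fun ω hω => ?_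
  rw [norm_mul]
  gcongr
  exact (norm_exp_I_mul_le hω z).trans (Real.exp_le_exp.2 (by gcongr))

theorem exists_of_eventually_cocompact {p : ℝ → Prop} (h : ∀ᶠ x in cocompact ℝ, p x) :
    ∃ R : ℝ, ∀ x : ℝ, R ≤ |x| → p x := by
  rw [cocompact_eq_atBot_atTop, eventually_sup] at h
  obtain ⟨a, ha⟩ := eventually_atBot.1 h.1
  obtain ⟨b, hb⟩ := eventually_atTop.1 h.2
  refine ⟨max (-a) b, fun x hx => ?_⟩
  rcases le_abs.1 hx with h | h
  · exact hb x ((le_max_right _ _).trans h)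
  · exact ha x (by linarith [le_max_left (-a) b])

/-- Decay along each horizontal line becomes uniform by compactness of the range of heights:
boundedness in a strip wider by `1` gives, through Cauchy's estimate, a Lipschitz bound in `η`
independent of `ξ`. -/
theorem vanishesInStrips_of_mem_paleyWiener {σ : ℝ} (hσ : 0 ≤ σ) {g : ℂ → ℂ}
    (hg : g ∈ PaleyWiener1 σ) (hd : Differentiable ℂ g) : VanishesInStrips g := by
  obtain ⟨F, hF, hgF⟩ := hg
  intro H ε hε
  obtain ⟨B, hB0, hB⟩ : ∃ B : ℝ, 0 < B ∧ ∀ z : ℂ, |z.im| ≤ H + 1 → ‖g z‖ ≤ B := by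
    refine ⟨(∫ ω in Set.Icc (-σ) σ, ‖F ω‖) * Real.exp (σ * (H + 1)) + 1, ?_, fun z hz => ?_⟩
    · have : 0 ≤ ∫ ω in Set.Icc (-σ) σ, ‖F ω‖ := integral_nonneg fun _ => norm_nonneg _
      positivity
    · rw [hgF]
      exact (norm_bandlimited_le hσ hF hz).trans (by linarith)
  have key : ∀ᶠ ξ in cocompact ℝ, ∀ η ∈ Set.Icc (-H) H, ‖g ((ξ : ℝ) + (η : ℝ) * Complex.I)‖ < ε := by
    refine isCompact_Icc.induction_on (p := fun s => ∀ᶠ ξ in cocompact ℝ, ∀ η ∈ s,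
      ‖g ((ξ : ℝ) + (η : ℝ) * Complex.I)‖ < ε) (by simp) ?_ ?_ ?_
    · exact fun s t hst ht => ht.mono fun ξ h η hη => h η (hst hη)
    · intro s t hs ht
      filter_upwards [hs, ht] with ξ h1 h2 η hη
      exact hη.elim (h1 η) (h2 η)
    · intro η₀ hη₀
      refine ⟨_, mem_nhdsWithin_of_mem_nhds (Metric.ball_mem_nhds η₀
        (show 0 < min (1 / 2) (ε / (4 * B)) by positivity)), ?_⟩
      have h1 : ∀ᶠ ξ : ℝ in cocompact ℝ, ‖g ((ξ : ℝ) + η₀ * Complex.I)‖ < ε / 2 := by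
        have := tendsto_bandlimited_horizontal σ F η₀
        simp_rw [← hgF] at this
        exact (tendsto_zero_iff_norm_tendsto_zero.1 this).eventually_lt_const (by linarith)
      filter_upwards [h1] with ξ hξ η hη
      rw [Metric.mem_ball, Real.dist_eq, lt_min_iff] at hη
      set c : ℂ := (ξ : ℂ) + η₀ * Complex.I with hc
      have hdist : ‖((ξ : ℂ) + η * Complex.I) - c‖ = |η - η₀| := by
        rw [hc, add_sub_add_left_eq_sub, ← sub_mul, norm_mul, Complex.norm_I, mul_one,
          ← Complex.ofReal_sub, Complex.norm_real, Real.norm_eq_abs]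
      have h2 := norm_sub_le_of_norm_le_closedBall (C := B) hd.differentiableOn
        (c := c) (w := (ξ : ℂ) + η * Complex.I) (fun w hw => hB w ?_) (by rw [hdist]; exact hη.1.le)
      · rw [hdist] at h2
        have h3 := norm_le_norm_add_norm_sub' (g ((ξ : ℂ) + η * Complex.I)) (g c)
        have h4 : 2 * B * |η - η₀| < ε / 2 := by
          have := hη.2
          rw [lt_div_iff₀ (by positivity)] at this
          linarith
        linarith
      · rw [Metric.mem_closedBall, dist_eq_norm] at hw
        have h5 := (Complex.abs_im_le_norm (w - c)).trans hw
        have h6 : c.im = η₀ := by simp [hc]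
        rw [Complex.sub_im, h6] at h5
        have h7 : |η₀| ≤ H := abs_le.2 hη₀
        have := abs_sub_abs_le_abs_sub w.im η₀
        linarith
  obtain ⟨R, hR⟩ := exists_of_eventually_cocompact key
  refine ⟨R, fun z h1 h2 => ?_⟩
  have := hR z.re h1 z.im (abs_le.1 h2)
  rwa [Complex.re_add_im] at this

theorem VanishesInStrips.deriv {g : ℂ → ℂ} (hg : VanishesInStrips g) (hd : Differentiable ℂ g) :
    VanishesInStrips (deriv g) := by
  intro H ε hε
  obtain ⟨R, hR⟩ := hg (H + 1) (ε / 2) (by linarith)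
  refine ⟨R + 1, fun z h1 h2 => ?_⟩
  have := Complex.norm_deriv_le_of_forall_mem_sphere_norm_le (c := z) (R := 1) (C := ε / 2)
    one_pos hd.diffContOnCl fun w hw => (hR w ?_ ?_).le
  · linarith
  all_goals
    rw [Metric.mem_sphere, dist_eq_norm] at hw
  · have h3 := Complex.abs_re_le_norm (w - z)
    rw [hw, Complex.sub_re, abs_sub_comm] at h3
    linarith [abs_sub_abs_le_abs_sub z.re w.re]
  · have h3 := Complex.abs_im_le_norm (w - z)
    rw [hw, Complex.sub_im] at h3
    linarith [abs_sub_abs_le_abs_sub w.im z.im]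

/-! ### The zeros of `A sin (π z) - g z` far from the imaginary axis -/

/-- From `|sin π(x + iy)|^2 = sin^2 πx + sinh^2 πy`, with Jordan's inequality for the sine and `y ≤
sinh y` for `y ≥ 0`. -/
theorem two_mul_norm_le_norm_sin {w : ℂ} (hw : |w.re| ≤ 1 / 2) :
    2 * ‖w‖ ≤ ‖Complex.sin (Real.pi * w)‖ := by
  have hpi := Real.pi_gt_three
  have e1 : Complex.sin (Real.pi * w) = ((Real.sin (Real.pi * w.re) * Real.cosh (Real.pi * w.im) : ℝ)
      : ℂ) + ((Real.cos (Real.pi * w.re) * Real.sinh (Real.pi * w.im) : ℝ) : ℂ) * Complex.I := by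
    have : (Real.pi : ℂ) * w = ((Real.pi * w.re : ℝ) : ℂ) + ((Real.pi * w.im : ℝ) : ℂ) * Complex.I := by
      conv_lhs => rw [← Complex.re_add_im w]
      push_cast; ring
    rw [this, Complex.sin_add_mul_I]
    push_cast; ring
  have e2 : ‖Complex.sin (Real.pi * w)‖ ^ 2
      = Real.sin (Real.pi * w.re) ^ 2 + Real.sinh (Real.pi * w.im) ^ 2 := by
    rw [e1, ← Complex.normSq_eq_norm_sq, Complex.normSq_add_mul_I, mul_pow, mul_pow]
    have h1 := Real.sin_sq_add_cos_sq (Real.pi * w.re)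
    have h2 := Real.cosh_sq (Real.pi * w.im)
    rw [h2]
    linear_combination Real.sinh (Real.pi * w.im) ^ 2 * h1
  have e3 : ‖w‖ ^ 2 = w.re ^ 2 + w.im ^ 2 := by
    rw [← Complex.normSq_eq_norm_sq, Complex.normSq_apply]; ring
  have e4 : 2 * |w.re| ≤ |Real.sin (Real.pi * w.re)| := by
    have := Real.mul_abs_le_abs_sin (x := Real.pi * w.re) (by
      rw [abs_mul, abs_of_pos Real.pi_pos]; nlinarith)
    rw [abs_mul, abs_of_pos Real.pi_pos] at this
    calc 2 * |w.re| = 2 / Real.pi * (Real.pi * |w.re|) := by field_simp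
      _ ≤ _ := this
  have e5 : 2 * |w.im| ≤ |Real.sinh (Real.pi * w.im)| := by
    rw [Real.abs_sinh, abs_mul, abs_of_pos Real.pi_pos]
    have : Real.pi * |w.im| ≤ Real.sinh (Real.pi * |w.im|) :=
      Real.self_le_sinh_iff.2 (by positivity)
    nlinarith [abs_nonneg w.im]
  have e6 := pow_le_pow_left₀ (by positivity) e4 2
  have e7 := pow_le_pow_left₀ (by positivity) e5 2
  rw [mul_pow, sq_abs, sq_abs] at e6 e7
  refine le_of_sq_le_sq ?_ (norm_nonneg _)
  rw [e2, mul_pow, e3]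
  linarith

theorem sin_pi_mul_eq (k : ℤ) (z : ℂ) :
    Complex.sin (Real.pi * z) = (-1) ^ k * Complex.sin (Real.pi * (z - k)) := by
  have h := Complex.sin_antiperiodic.add_int_mul_eq k (x := Real.pi * (z - k))
  rw [Int.cast_negOnePow] at h
  rw [← h]
  congr 1
  ring

theorem cos_pi_mul_eq (k : ℤ) (z : ℂ) :
    Complex.cos (Real.pi * z) = (-1) ^ k * Complex.cos (Real.pi * (z - k)) := by
  have h := Complex.cos_antiperiodic.add_int_mul_eq k (x := Real.pi * (z - k))
  rw [Int.cast_negOnePow] at h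
  rw [← h]
  congr 1
  ring

theorem abs_re_sub_round_le (z : ℂ) : |(z - round z.re).re| ≤ 1 / 2 := by
  simpa using abs_sub_round z.re

theorem deriv_eq_of_eq_sin_sub {A : ℝ} {g φ : ℂ → ℂ}
    (hφ : ∀ z : ℂ, φ z = A * Complex.sin (Real.pi * z) - g z)
    (hd : Differentiable ℂ g) (z : ℂ) :
    deriv φ z = A * Real.pi * Complex.cos (Real.pi * z) - deriv g z := by
  have h1 : HasDerivAt (fun z : ℂ => Complex.sin (Real.pi * z))
      (Complex.cos (Real.pi * z) * Real.pi) z := by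
    have := ((hasDerivAt_id z).const_mul (Real.pi : ℂ)).csin
    simpa using this
  have h2 := (h1.const_mul (A : ℂ)).sub (hd z).hasDerivAt
  have h3 : HasDerivAt φ (A * (Complex.cos (Real.pi * z) * Real.pi) - deriv g z) z :=
    h2.congr_of_eventuallyEq (Eventually.of_forall hφ)
  rw [h3.deriv]
  ring

theorem exists_zeros_near_int {A : ℝ} {g φ : ℂ → ℂ}
    (hA : 0 < A)
    (hφ : ∀ z : ℂ, φ z = A * Complex.sin (Real.pi * z) - g z)
    (hd : Differentiable ℂ g) (hg : VanishesInStrips g) {H : ℝ}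
    (hH : ∀ z, φ z = 0 → |z.im| ≤ H) {ρ : ℝ} (hρ : 0 < ρ) :
    ∃ R : ℝ, ∀ z, φ z = 0 → R ≤ |z.re| →
      ‖z - round z.re‖ ≤ ρ ∧ ‖(-1) ^ round z.re * deriv φ z - A * Real.pi‖ ≤ ρ := by
  have hpi := Real.pi_pos
  have hcont : ContinuousAt (fun w : ℂ => Complex.cos (Real.pi * w)) 0 := by fun_prop
  obtain ⟨d, hd0, hdc⟩ := Metric.continuousAt_iff.1 hcont (ρ / (2 * (A * Real.pi))) (by positivity)
  obtain ⟨R₁, hR₁⟩ := hg H (2 * A * min ρ (d / 2)) (by positivity)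
  obtain ⟨R₂, hR₂⟩ := hg.deriv hd H (ρ / 2) (by positivity)
  refine ⟨max R₁ R₂, fun z hz hzR => ?_⟩
  have h1 := hR₁ z ((le_max_left _ _).trans hzR) (hH z hz)
  have h2 := hR₂ z ((le_max_right _ _).trans hzR) (hH z hz)
  set k := round z.re with hk
  have h3 : ‖z - k‖ < min ρ (d / 2) := by
    have h4 := two_mul_norm_le_norm_sin (abs_re_sub_round_le z)
    have h5 : g z = A * Complex.sin (Real.pi * z) := by
      have := hφ z
      rw [hz] at this
      linear_combination this
    rw [h5, sin_pi_mul_eq k, norm_mul, norm_mul, norm_neg_one_zpow, one_mul, Complex.norm_real,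
      Real.norm_eq_abs, abs_of_pos hA] at h1
    have h6 : A * (2 * ‖z - k‖) < A * (2 * min ρ (d / 2)) :=
      (mul_le_mul_of_nonneg_left h4 hA.le).trans_lt (h1.trans_eq (by ring))
    linarith [lt_of_mul_lt_mul_left h6 hA.le]
  obtain ⟨h3a, h3b⟩ := lt_min_iff.1 h3
  refine ⟨h3a.le, ?_⟩
  have h7 : ‖Complex.cos (Real.pi * (z - k)) - 1‖ < ρ / (2 * (A * Real.pi)) := by
    have := hdc (x := z - k) (by rw [dist_zero_right]; linarith)
    simpa [dist_eq_norm] using this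
  rw [deriv_eq_of_eq_sin_sub hφ hd, cos_pi_mul_eq k]
  have h8 : (-1 : ℂ) ^ k * (A * Real.pi * ((-1) ^ k * Complex.cos (Real.pi * (z - k))) - deriv g z)
      - A * Real.pi = (A * Real.pi : ℝ) * (Complex.cos (Real.pi * (z - k)) - 1)
        - (-1) ^ k * deriv g z := by
    have := neg_one_zpow_mul_self k
    push_cast
    linear_combination (A * Real.pi * Complex.cos (Real.pi * (z - k))) * this
  rw [h8]
  refine (norm_sub_le _ _).trans ?_
  rw [norm_mul, norm_mul, norm_neg_one_zpow, one_mul, Complex.norm_real, Real.norm_eq_abs,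
    abs_of_pos (by positivity)]
  rw [lt_div_iff₀ (by positivity)] at h7
  linarith

/-- A quantitative open mapping argument in place of Rouché: on the circle of radius `1/4` around
`k`, `φ` stays `A/4` away from `φ k`, so the image of the closed disc contains the disc of radius
`A/8` about `φ k`. That disc contains `0` because `φ k = -g k` is small. -/
theorem exists_zero_near_int {A : ℝ} {g φ : ℂ → ℂ}
    (hA : 0 < A)
    (hφ : ∀ z : ℂ, φ z = A * Complex.sin (Real.pi * z) - g z)
    (hd : Differentiable ℂ g) (hg : VanishesInStrips g) :
    ∃ K : ℝ, ∀ k : ℤ, K ≤ |(k : ℝ)| → ∃ z, φ z = 0 ∧ ‖z - k‖ ≤ 1 / 4 := by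
  obtain ⟨R, hR⟩ := hg 1 (A / 8) (by positivity)
  have hdφ : Differentiable ℂ φ := by
    rw [funext hφ]
    fun_prop
  refine ⟨R + 1, fun k hk => ?_⟩
  have hgb : ∀ w ∈ Metric.closedBall (k : ℂ) (1 / 4), ‖g w‖ < A / 8 := by
    intro w hw
    rw [Metric.mem_closedBall, dist_eq_norm] at hw
    refine hR w ?_ ?_
    · have h3 := Complex.abs_re_le_norm (w - k)
      simp only [Complex.sub_re, Complex.intCast_re] at h3
      rw [abs_sub_comm] at h3
      linarith [abs_sub_abs_le_abs_sub (k : ℝ) w.re]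
    · have h3 := Complex.abs_im_le_norm (w - k)
      simp only [Complex.sub_im, Complex.intCast_im, sub_zero] at h3
      linarith
  have hφk : φ k = - g k := by
    rw [hφ, sin_pi_mul_eq k]; simp
  have hgk := hgb k (Metric.mem_closedBall_self (by norm_num))
  have hsphere : ∀ z ∈ Metric.sphere (k : ℂ) (1 / 4), A / 4 ≤ ‖φ z - φ k‖ := by
    intro z hz
    have hgz := hgb z (Metric.sphere_subset_closedBall hz)
    rw [Metric.mem_sphere, dist_eq_norm] at hz
    have h4 := two_mul_norm_le_norm_sin (w := z - k)
      ((Complex.abs_re_le_norm _).trans (by rw [hz]; norm_num))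
    rw [hφk, hφ, sin_pi_mul_eq k]
    have h5 : ‖(A : ℂ) * ((-1) ^ k * Complex.sin (Real.pi * (z - k)))‖
        = A * ‖Complex.sin (Real.pi * (z - k))‖ := by
      rw [norm_mul, norm_mul, norm_neg_one_zpow, one_mul, Complex.norm_real,
        Real.norm_eq_abs, abs_of_pos hA]
    have h6 : A * (1 / 2) ≤ A * ‖Complex.sin (Real.pi * (z - k))‖ := by
      gcongr
      rw [hz] at h4
      linarith
    rw [sub_neg_eq_add]
    have h7 := norm_sub_norm_le ((A : ℂ) * ((-1) ^ k * Complex.sin (Real.pi * (z - k)))) (g z - g k)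
    rw [show (A : ℂ) * ((-1) ^ k * Complex.sin (Real.pi * (z - k))) - (g z - g k)
      = (A : ℂ) * ((-1) ^ k * Complex.sin (Real.pi * (z - k))) - g z + g k by ring, h5] at h7
    have h8 := norm_sub_le (g z) (g k)
    linarith
  have hfreq : ∃ᶠ z in 𝓝 (k : ℂ), φ z ≠ φ k := by
    intro hev
    have hev' : φ =ᶠ[𝓝 (k : ℂ)] fun _ => φ k := hev.mono fun z hz => by simpa using hz
    have := AnalyticOnNhd.eq_of_eventuallyEq (fun z _ => hdφ.analyticAt z)
      (fun z _ => analyticAt_const) hev'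
    have h1 := hsphere (k + (1 / 4 : ℝ)) (by
      rw [Metric.mem_sphere, dist_eq_norm, add_sub_cancel_left, Complex.norm_real]; norm_num)
    rw [congrFun this (k + (1 / 4 : ℝ)), sub_self, norm_zero] at h1
    linarith
  have := hdφ.diffContOnCl.ball_subset_image_closedBall (by norm_num : (0 : ℝ) < 1 / 4)
    hsphere hfreq
  obtain ⟨z, hz, hz0⟩ := this (show (0 : ℂ) ∈ Metric.ball (φ k) (A / 4 / 2) by
    rw [Metric.mem_ball, dist_eq_norm, zero_sub, norm_neg, hφk, norm_neg]
    linarith)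
  exact ⟨z, hz0, by rwa [Metric.mem_closedBall, dist_eq_norm] at hz⟩

/-! ### Enumerations of separated sets in a strip -/

theorem not_bounded_re_of_separated {u : ℕ → ℂ} (hinj : Function.Injective u) {δ H B : ℝ}
    (hδ : 0 < δ) (hsep : ∀ m n, u m ≠ u n → δ ≤ ‖u m - u n‖) (him : ∀ n, |(u n).im| ≤ H)
    (hre : ∀ n, |(u n).re| ≤ B) : False := by
  have hb : ∀ n, u n ∈ Metric.closedBall (0 : ℂ) (B + H) := fun n => by
    rw [Metric.mem_closedBall, dist_zero_right]
    exact (Complex.norm_le_abs_re_add_abs_im _).trans (add_le_add (hre n) (him n))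
  obtain ⟨a, -, ψ, hψ, ha⟩ := (isCompact_closedBall (0 : ℂ) (B + H)).tendsto_subseq hb
  obtain ⟨n, hn⟩ := eventually_atTop.1 (Metric.tendsto_nhds.1 ha (δ / 2) (by linarith))
  have h1 := hn n le_rfl
  have h2 := hn (n + 1) n.le_succ
  have h3 := hsep (ψ n) (ψ (n + 1)) (hinj.ne (hψ.injective.ne (by omega)))
  rw [← dist_eq_norm] at h3
  have := dist_triangle_right (u (ψ n)) (u (ψ (n + 1))) a
  simp only [Function.comp] at h1 h2
  linarith

theorem tendsto_re_atTop_of_separated {Λ : ℤ → ℂ} (hinj : Function.Injective Λ)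
    (hmono : Monotone fun n => (Λ n).re) {δ H : ℝ} (hδ : 0 < δ)
    (hsep : ∀ m n, Λ m ≠ Λ n → δ ≤ ‖Λ m - Λ n‖) (him : ∀ n, |(Λ n).im| ≤ H) :
    Tendsto (fun n => (Λ n).re) atTop atTop := by
  refine tendsto_atTop_atTop_of_monotone hmono fun b => ?_
  by_contra! h
  refine not_bounded_re_of_separated (u := fun n : ℕ => Λ n) (hinj.comp Nat.cast_injective) hδ
    (fun m n => hsep m n) (fun n => him n) (B := max b (-(Λ 0).re)) fun n => ?_
  have h1 : (Λ 0).re ≤ (Λ (n : ℤ)).re := hmono (Int.natCast_nonneg n)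
  refine abs_le.2 ⟨?_, (h n).le.trans (le_max_left _ _)⟩
  linarith [le_max_right b (-(Λ 0).re)]

theorem tendsto_re_atBot_of_separated {Λ : ℤ → ℂ} (hinj : Function.Injective Λ)
    (hmono : Monotone fun n => (Λ n).re) {δ H : ℝ} (hδ : 0 < δ)
    (hsep : ∀ m n, Λ m ≠ Λ n → δ ≤ ‖Λ m - Λ n‖) (him : ∀ n, |(Λ n).im| ≤ H) :
    Tendsto (fun n => (Λ n).re) atBot atBot := by
  have := tendsto_re_atTop_of_separated (Λ := fun n => -Λ (-n))
    (fun m n h => neg_injective (hinj (neg_injective h)))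
    (fun m n h => by simpa using hmono (neg_le_neg h)) hδ
    (fun m n h => by
      have := hsep (-m) (-n) (fun h' => h (by simp [h']))
      rwa [neg_sub_neg, norm_sub_rev]) (H := H) (fun n => by simpa using him (-n))
  have h2 := tendsto_neg_atTop_atBot.comp (this.comp tendsto_neg_atBot_atTop)
  refine h2.congr fun n => ?_
  simp

/-- Far to the right, two consecutive zeros cannot round to the same integer, by separation, and
cannot skip one, since the skipped integer has a zero nearby whose index would lie strictly between
two consecutive indices. -/
theorem exists_shift_of_zeros {φ : ℂ → ℂ} {Λ : ℤ → ℂ}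
    (hinj : Function.Injective Λ) (hrange : Set.range Λ = {z : ℂ | φ z = 0})
    (hmono : Monotone fun n => (Λ n).re) {δ ρ R K : ℝ}
    (hsep : ∀ z w : ℂ, φ z = 0 → φ w = 0 → z ≠ w → δ ≤ ‖z - w‖)
    (hρ : 2 * ρ < δ) (hρ4 : ρ ≤ 1 / 4)
    (hnear : ∀ z, φ z = 0 → R ≤ |z.re| → ‖z - round z.re‖ ≤ ρ)
    (hex : ∀ k : ℤ, K ≤ |(k : ℝ)| → ∃ z, φ z = 0 ∧ ‖z - k‖ ≤ 1 / 4)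
    (htop : Tendsto (fun n => (Λ n).re) atTop atTop) :
    ∃ n₀ n₁ : ℤ, ∀ n, n₁ ≤ n → round (Λ n).re = n + n₀ := by
  have hzero : ∀ n, φ (Λ n) = 0 := fun n => by
    have : Λ n ∈ Set.range Λ := ⟨n, rfl⟩
    rwa [hrange] at this
  obtain ⟨n₁, hn₁⟩ := eventually_atTop.1 (htop.eventually_ge_atTop (max R (max K 0)))
  have hnear' : ∀ n, n₁ ≤ n → ‖Λ n - round (Λ n).re‖ ≤ ρ := fun n hn =>
    hnear _ (hzero n) (((le_max_left _ _).trans (hn₁ n hn)).trans (le_abs_self _))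
  have hstep : ∀ n, n₁ ≤ n → round (Λ (n + 1)).re = round (Λ n).re + 1 := by
    intro n hn
    have a1 := hnear' n hn
    have a2 := hnear' (n + 1) (by omega)
    have hm : (Λ n).re ≤ (Λ (n + 1)).re := hmono (by omega)
    have b1 := abs_le.1 ((Complex.abs_re_le_norm _).trans a1)
    have b2 := abs_le.1 ((Complex.abs_re_le_norm _).trans a2)
    set k := round (Λ n).re with hk
    set k' := round (Λ (n + 1)).re with hk'
    simp only [Complex.sub_re, Complex.intCast_re] at b1 b2
    have hne : k ≠ k' := by
      intro h
      have h1 := hsep _ _ (hzero n) (hzero (n + 1)) (hinj.ne (by omega))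
      rw [← h] at a2
      have h2 := norm_sub_le (Λ n - k) (Λ (n + 1) - k)
      rw [sub_sub_sub_cancel_right] at h2
      linarith
    have hle : k < k' + 1 := by
      have : (k : ℝ) < k' + 1 := by linarith [b1.2, b2.2, b1.1, b2.1]
      exact_mod_cast this
    by_contra hcon
    have hge : k + 2 ≤ k' := by omega
    have hge' : (k : ℝ) + 2 ≤ k' := by exact_mod_cast hge
    have hbig := hn₁ n hn
    have hK : K ≤ |((k + 1 : ℤ) : ℝ)| := by
      refine le_trans ?_ (le_abs_self _)
      push_cast
      have := le_trans (le_trans (le_max_left K 0) (le_max_right R _)) hbig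
      linarith [b1.1, b1.2]
    obtain ⟨z, hz0, hz⟩ := hex (k + 1) hK
    obtain ⟨m, rfl⟩ : z ∈ Set.range Λ := by rw [hrange]; exact hz0
    have b3 := abs_le.1 ((Complex.abs_re_le_norm _).trans hz)
    simp only [Complex.sub_re, Complex.intCast_re] at b3
    push_cast at b3
    have c1 : n < m := hmono.reflect_lt (show (Λ n).re < (Λ m).re by linarith [b1.2, b3.1])
    have c2 : m < n + 1 := hmono.reflect_lt
      (show (Λ m).re < (Λ (n + 1)).re by linarith [b2.1, b3.2])
    omega
  refine ⟨round (Λ n₁).re - n₁, n₁, fun n hn => ?_⟩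
  induction n, hn using Int.leInduction with
  | base => ring
  | succ n hn ih => rw [hstep n hn, ih]; ring

/-! ### The maximum of a sampling series -/

theorem interpKernel_eq_dslope {φ : ℂ → ℂ} {μ : ℂ} (h0 : φ μ = 0) (h1 : deriv φ μ ≠ 0) (z : ℂ) :
    interpKernel φ μ z = dslope φ μ z / deriv φ μ := by
  unfold interpKernel
  split_ifs with h
  · rw [h, dslope_same, div_self h1]
  · rw [dslope_of_ne _ h, slope_def_field, h0, sub_zero, div_div, mul_comm]

theorem continuous_interpKernel {φ : ℂ → ℂ} (hφ : Differentiable ℂ φ) {μ : ℂ} (h0 : φ μ = 0)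
    (h1 : deriv φ μ ≠ 0) : Continuous (interpKernel φ μ) := by
  rw [funext (interpKernel_eq_dslope h0 h1)]
  refine Continuous.div_const ?_ _
  rw [← continuousOn_univ, continuousOn_dslope univ_mem]
  exact ⟨hφ.continuous.continuousOn, hφ μ⟩

theorem tendsto_interpKernel {φ : ℂ → ℂ} {B : ℝ} (hB : ∀ t : ℝ, ‖φ t‖ ≤ B) (μ : ℂ) :
    Tendsto (fun t : ℝ => interpKernel φ μ t) (cocompact ℝ) (𝓝 0) := by
  have h1 : Tendsto (fun t : ℝ => ‖deriv φ μ * ((t : ℂ) - μ)‖⁻¹ * B) (cocompact ℝ) (𝓝 0) := by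
    by_cases hd : deriv φ μ = 0
    · simp [hd]
    have h2 : Tendsto (fun t : ℝ => ‖deriv φ μ‖ * (‖t‖ - ‖μ‖)) (cocompact ℝ) atTop :=
      (tendsto_atTop_add_const_right _ _ (tendsto_norm_cocompact_atTop (E := ℝ))).const_mul_atTop
        (norm_pos_iff.2 hd)
    have h3 : Tendsto (fun t : ℝ => ‖deriv φ μ * ((t : ℂ) - μ)‖) (cocompact ℝ) atTop := by
      refine tendsto_atTop_mono (fun t => ?_) h2
      rw [norm_mul]
      gcongr
      have := norm_sub_norm_le (t : ℂ) μ
      rwa [Complex.norm_real] at this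
    simpa using h3.inv_tendsto_atTop.mul_const B
  refine squeeze_zero_norm' ?_ h1
  have h4 : ∀ᶠ t : ℝ in cocompact ℝ, ‖μ‖ < ‖t‖ :=
    (tendsto_norm_cocompact_atTop (E := ℝ)).eventually_gt_atTop _
  filter_upwards [h4] with t ht
  have hne : (t : ℂ) ≠ μ := by
    rintro rfl
    rw [Complex.norm_real] at ht
    exact lt_irrefl _ ht
  unfold interpKernel
  rw [if_neg hne, norm_div, div_eq_inv_mul]
  gcongr
  exact hB t

theorem exists_isGreatest_norm {u : ℝ → ℂ} (hc : Continuous u) (h0 : Tendsto u (cocompact ℝ) (𝓝 0)) :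
    ∃ M : ℝ, IsGreatest (Set.range fun t => ‖u t‖) M ∧
      eLpNorm u ⊤ volume = ENNReal.ofReal M := by
  obtain ⟨t₀, ht₀⟩ : ∃ t₀, ∀ t, ‖u t‖ ≤ ‖u t₀‖ := by
    -- A nonzero value is needed as the level below which `u` falls at infinity.
    by_cases hz : ∀ t, u t = 0
    · exact ⟨0, fun t => by simp [hz]⟩
    · push Not at hz
      obtain ⟨t₁, ht₁⟩ := hz
      refine hc.norm.exists_forall_ge' t₁ ?_
      have := (tendsto_zero_iff_norm_tendsto_zero.1 h0).eventually_lt_const (norm_pos_iff.2 ht₁)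
      exact this.mono fun t ht => ht.le
  refine ⟨‖u t₀‖, ⟨⟨t₀, rfl⟩, by rintro _ ⟨t, rfl⟩; exact ht₀ t⟩, ?_⟩
  rw [eLpNorm_exponent_top, eLpNormEssSup, ← iSup_eq_essSup]
  · refine le_antisymm (iSup_le fun t => ?_) ?_
    · rw [← ofReal_norm]
      exact ENNReal.ofReal_le_ofReal (ht₀ t)
    · rw [ofReal_norm]
      exact le_iSup (fun t => ‖u t‖ₑ) t₀
  · intro t a ha
    exact (isOpen_lt continuous_const hc.enorm).measure_ne_zero volume ⟨t, ha⟩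

/-! ### Lower bounds -/

/-- The constant in the Lipschitz estimate for the test function near the integers. -/
def testConst : ℝ := 192 * Real.exp Real.pi

theorem one_le_testConst : 1 ≤ testConst := by
  have := Real.add_one_le_exp Real.pi
  have := Real.pi_pos
  unfold testConst
  linarith

/-- The term equals `(u / q) / (t - k)`, where `u = (-1)^k f(l)` has real part at least `31/32` of
the weight and `q` is close to `1`. Because `u` is complex, perturbing `q` costs a multiple of
`‖u‖`, which is why an upper bound by the weight is needed too. With `M = testConst` and `m = 1/(32
* M)` this cost is at most a quarter of the weight, so half of it survives. -/
theorem edgeWeight_le_re_term {b : ℝ} (hb : 0 < b) {k : ℤ} (hk : 3 ≤ k.natAbs) {l d : ℂ}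
    (hl : ‖l - k‖ ≤ 1 / (32 * testConst)) (hd : ‖(-1) ^ k * d - b‖ ≤ b / (32 * testConst)) {t : ℝ}
    (ht : k + 1 / 2 ≤ t) :
    edgeWeight k.natAbs / (2 * (t - k)) ≤ (b * testFun l / (d * (t - l))).re := by
  have hM := one_le_testConst
  set M := testConst with hMdef
  have ha := edgeWeight_pos k.natAbs
  set a := edgeWeight k.natAbs with hadef
  have hs : 0 < t - k := by linarith
  have hsc : ((t - k : ℝ) : ℂ) ≠ 0 := by exact_mod_cast hs.ne'
  have hbc : (b : ℂ) ≠ 0 := by exact_mod_cast hb.ne'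
  have hM32 : 1 / (32 * M) ≤ 1 / 32 := one_div_le_one_div_of_le (by norm_num) (by linarith)
  have hMM : M * (1 / (32 * M)) = 1 / 32 := by field_simp
  have hMM0 : 0 < 1 / (32 * M) := by positivity
  set m := 1 / (32 * M) with hm
  have hdm : b / (32 * M) = b * m := by rw [hm]; ring
  rw [hdm] at hd
  -- the numerator
  set u : ℂ := (-1) ^ k * testFun l with hu
  have hf1 : ‖testFun l - testFun k‖ ≤ M * a * m := by
    refine (norm_testFun_sub_le hk (by linarith)).trans ?_
    calc _ = M * a * ‖l - k‖ := by rw [hMdef, testConst]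
      _ ≤ _ := by gcongr
  have hf1' : M * a * m = a / 32 := by linear_combination a * hMM
  rw [hf1'] at hf1
  have hu1 : ‖u - (-1) ^ k * testFun k‖ ≤ a / 32 := by
    rw [hu, ← mul_sub, norm_mul, norm_neg_one_zpow, one_mul]
    exact hf1
  have hure : a - a / 32 ≤ u.re := by
    have h1 := (abs_le.1 ((Complex.abs_re_le_norm _).trans hu1)).1
    rw [Complex.sub_re] at h1
    linarith [edgeWeight_le_re_testFun (k := k) (by omega)]
  have hun : ‖u‖ ≤ M * a := by
    have h1 := norm_le_norm_add_norm_sub' (testFun l) (testFun k)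
    have h2 := norm_testFun_int_le hk
    rw [hu, norm_mul, norm_neg_one_zpow, one_mul]
    have h3 : 96 * Real.exp Real.pi * a = M * a / 2 := by rw [hMdef, testConst]; ring
    nlinarith
  -- the denominator
  set q : ℂ := ((-1) ^ k * d / b) * (1 - (l - k) / (t - k : ℝ)) with hq
  have hd1 : ‖(-1) ^ k * d / b - 1‖ ≤ m := by
    rw [show (-1) ^ k * d / b - 1 = ((-1) ^ k * d - b) / b by field_simp, norm_div,
      Complex.norm_real, Real.norm_eq_abs, abs_of_pos hb, div_le_iff₀ hb]
    linarith
  have hl1 : ‖(l - k) / ((t - k : ℝ) : ℂ)‖ ≤ 2 * m := by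
    rw [norm_div, Complex.norm_real, Real.norm_eq_abs, abs_of_pos hs, div_le_iff₀ hs]
    nlinarith
  have hq1 : ‖q - 1‖ ≤ 4 * m := by
    set x := (-1) ^ k * d / (b : ℂ)
    set y := (l - k) / ((t - k : ℝ) : ℂ)
    have : q - 1 = (x - 1) - (x - 1) * y - y := by rw [hq]; ring
    rw [this]
    have h1 := norm_sub_le ((x - 1) - (x - 1) * y) y
    have h2 := norm_sub_le (x - 1) ((x - 1) * y)
    rw [norm_mul] at h2
    have h3 : ‖x - 1‖ * ‖y‖ ≤ m * (2 * m) := by gcongr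
    nlinarith
  have hqn : 1 / 2 ≤ ‖q‖ := by
    have := norm_sub_norm_le 1 q
    rw [norm_one, norm_sub_rev] at this
    linarith
  have hq0 : q ≠ 0 := norm_pos_iff.1 (by linarith)
  have hT : (b * testFun l / (d * (t - l))) = ((1 / (t - k) : ℝ) : ℂ) * (u / q) := by
    have hsub : 1 - (l - k) / ((t - k : ℝ) : ℂ) = (t - l) / ((t - k : ℝ) : ℂ) := by
      rw [eq_div_iff hsc, sub_mul, div_mul_cancel₀ _ hsc]
      push_cast; ring
    have hqd : q * (b * ((t - k : ℝ) : ℂ)) = (-1) ^ k * (d * (t - l)) := by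
      rw [hq, hsub]; field_simp
    have hne := neg_one_zpow_mul_self k
    have hk0 : (-1 : ℂ) ^ k ≠ 0 := left_ne_zero_of_mul_eq_one hne
    have hdl : d * ((t : ℂ) - l) ≠ 0 := by
      intro h
      rw [h, mul_zero] at hqd
      exact mul_ne_zero hq0 (mul_ne_zero hbc hsc) hqd
    rw [Complex.ofReal_div, Complex.ofReal_one, div_mul_div_comm, one_mul,
      div_eq_div_iff hdl (mul_ne_zero hsc hq0), hu]
    linear_combination (testFun l) * hqd
  rw [hT, Complex.re_ofReal_mul]
  have hfin : a / 2 ≤ (u / q).re := by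
    have h1 : ‖u / q - u‖ ≤ a / 4 := by
      rw [show u / q - u = u * (1 - q) / q by field_simp, norm_div, norm_mul,
        norm_sub_rev, div_le_iff₀ (by linarith)]
      calc ‖u‖ * ‖q - 1‖ ≤ (M * a) * (4 * m) := by gcongr
        _ = a / 8 := by linear_combination 4 * a * hMM
        _ ≤ _ := by nlinarith
    have h2 := (abs_le.1 ((Complex.abs_re_le_norm _).trans h1)).1
    rw [Complex.sub_re] at h2
    linarith
  calc a / (2 * (t - k)) = 1 / (t - k) * (a / 2) := by field_simp
    _ ≤ _ := by gcongr

theorem log_le_sum_inv (L : ℕ) :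
    Real.log (L + 2) ≤ ∑ i ∈ Finset.range (L + 1), 1 / ((i : ℝ) + 1) := by
  have h := log_add_one_le_harmonic (L + 1)
  rw [harmonic] at h
  push_cast at h
  simp_rw [one_div]
  rw [show (L : ℝ) + 2 = L + 1 + 1 by ring]
  exact h

theorem le_sum_of_le_on_Icc {T C : ℤ → ℝ} (hC : ∀ n, 0 ≤ C n) {n₁ : ℤ} (hn₁ : 0 < n₁)
    {L : ℕ} {a : ℝ} (ha : 0 ≤ a) {N : ℕ} (hN : (N : ℤ) = n₁ + L)
    (hpos : ∀ n, n₁ ≤ n → n ≤ N → a / (N - n + 1) ≤ T n)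
    (hneg : ∀ n, n ≤ -n₁ → 0 ≤ T n)
    (hmid : ∀ n, -n₁ < n → n < n₁ → -C n ≤ T n) :
    a * Real.log (L + 2) - ∑ n ∈ Finset.Icc (-n₁) n₁, C n
      ≤ ∑ n ∈ Finset.Icc (-(N : ℤ)) N, T n := by
  have h1 : ∀ n ∈ Finset.Icc (-(N : ℤ)) N, (if n₁ ≤ n then a / ((N : ℝ) - n + 1) else 0)
      - (if n ∈ Finset.Icc (-n₁) n₁ then C n else 0) ≤ T n := by
    intro n hn
    rw [Finset.mem_Icc] at hn
    have hCi : 0 ≤ if n ∈ Finset.Icc (-n₁) n₁ then C n else 0 := by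
      split_ifs
      exacts [hC n, le_rfl]
    rcases le_or_gt n₁ n with h | h
    · rw [if_pos h]
      linarith [hpos n h hn.2]
    · rw [if_neg (by omega)]
      rcases le_or_gt n (-n₁) with h' | h'
      · linarith [hneg n h']
      · rw [if_pos (Finset.mem_Icc.2 ⟨h'.le, h.le⟩)]
        linarith [hmid n h' h]
  refine le_trans ?_ (Finset.sum_le_sum h1)
  rw [Finset.sum_sub_distrib]
  refine sub_le_sub ?_ ?_
  · rw [← Finset.sum_filter]
    have h2 : ∑ i ∈ Finset.range (L + 1), a * (1 / ((i : ℝ) + 1))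
        = ∑ n ∈ Finset.filter (fun n => n₁ ≤ n) (Finset.Icc (-(N : ℤ)) N),
          a / ((N : ℝ) - n + 1) := by
      refine Finset.sum_nbij' (fun i : ℕ => (N : ℤ) - i) (fun n => ((N : ℤ) - n).toNat) ?_ ?_ ?_ ?_ ?_
      · intro i hi
        rw [Finset.mem_range] at hi
        rw [Finset.mem_filter, Finset.mem_Icc]
        omega
      · intro n hn
        rw [Finset.mem_filter, Finset.mem_Icc] at hn
        rw [Finset.mem_range]
        omega
      · intro i _
        simp
      · intro n hn
        rw [Finset.mem_filter, Finset.mem_Icc] at hn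
        omega
      · intro i _
        push_cast
        rw [sub_sub_cancel, mul_one_div]
    rw [← h2, ← Finset.mul_sum]
    exact mul_le_mul_of_nonneg_left (log_le_sum_inv L) ha
  · rw [← Finset.sum_filter]
    refine Finset.sum_le_sum_of_subset_of_nonneg (fun n hn => (Finset.mem_filter.1 hn).2)
      fun n _ _ => hC n

/-- For `L ≥ c` one has `L + c ≤ (L + 2)^2`, so the shift costs at most a factor `2` in the
logarithm. -/
theorem tendsto_edgeWeight_mul_log_shift {c : ℕ} (hc : 3 ≤ c) :
    Tendsto (fun L : ℕ => edgeWeight (L + c) * Real.log (L + 2)) atTop atTop := by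
  have h1 : Tendsto (fun L : ℕ => edgeWeight (L + c) * Real.log ((L + c : ℕ) : ℝ) * (1 / 2))
      atTop atTop :=
    (tendsto_edgeWeight_mul_log.comp (tendsto_add_atTop_nat c)).atTop_mul_const (by norm_num)
  refine tendsto_atTop_mono' _ ?_ h1
  filter_upwards [eventually_ge_atTop c] with L hL
  rw [mul_assoc]
  refine mul_le_mul_of_nonneg_left ?_ (edgeWeight_pos _).le
  have hL' : (c : ℝ) ≤ L := by exact_mod_cast hL
  have hc' : (3 : ℝ) ≤ c := by exact_mod_cast hc
  have h2 : Real.log ((L + c : ℕ) : ℝ) ≤ Real.log (((L : ℝ) + 2) ^ 2) := by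
    refine Real.log_le_log (by push_cast; linarith) ?_
    push_cast
    nlinarith
  rw [Real.log_pow] at h2
  push_cast at h2 ⊢
  linarith

theorem norm_sin_pi_mul_half_odd (k : ℤ) :
    ‖Complex.sin (Real.pi * ((k : ℂ) + 1 / 2))‖ = 1 := by
  rw [sin_pi_mul_eq k, norm_mul, norm_neg_one_zpow, one_mul, add_sub_cancel_left,
    show (Real.pi : ℂ) * (1 / 2) = Real.pi / 2 by ring, Complex.sin_pi_div_two, norm_one]

end

/-! ### Strong divergence for the test function -/

theorem theorem12 (g : ℂ → ℂ) (hg : g ∈ PaleyWiener1 Real.pi)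
    (A : ℝ) (hA : paleyWiener1Norm Real.pi g < A)
    (φ : ℂ → ℂ) (hφ : ∀ z : ℂ, φ z = (A : ℂ) * Complex.sin ((Real.pi : ℂ) * z) - g z)
    (hsine : IsSineType φ)
    (Λ : ℤ → ℂ) (hΛinj : Function.Injective Λ) (hΛrange : Set.range Λ = {z : ℂ | φ z = 0})
    (hΛmono : Monotone fun n : ℤ => (Λ n).re) :
    ∃ f ∈ PaleyWiener1 Real.pi, ∃ M : ℕ → ℝ,
      (∀ N : ℕ, IsGreatest (Set.range fun t : ℝ => ‖samplingSeries φ Λ N f (t : ℂ)‖) (M N)) ∧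
      (∀ N : ℕ, eLpNorm (fun t : ℝ => samplingSeries φ Λ N f (t : ℂ)) ⊤ volume
        = ENNReal.ofReal (M N)) ∧
      Tendsto M atTop atTop := by
  have hpi := Real.pi_pos
  have hA0 : 0 < A := by
    refine lt_of_le_of_lt (Real.sInf_nonneg ?_) hA
    rintro r ⟨F, -, rfl⟩
    exact mul_nonneg (by positivity) (integral_nonneg fun _ => norm_nonneg _)
  have hdφ : Differentiable ℂ φ := hsine.expType.1
  have hgd : Differentiable ℂ g := by
    have : g = fun z => A * Complex.sin (Real.pi * z) - φ z := by
      funext z; rw [hφ]; ring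
    rw [this]; fun_prop
  have hgv : VanishesInStrips g := vanishesInStrips_of_mem_paleyWiener hpi.le hg hgd
  have hzero : ∀ n, φ (Λ n) = 0 := fun n => by
    have : Λ n ∈ Set.range Λ := ⟨n, rfl⟩
    rwa [hΛrange] at this
  have hsimple : ∀ n, deriv φ (Λ n) ≠ 0 := fun n => hsine.simple _ (hzero n)
  -- boundedness on the real line and the maxima
  obtain ⟨B, hB⟩ : ∃ B : ℝ, ∀ t : ℝ, ‖φ t‖ ≤ B := by
    obtain ⟨F, hF, hgF⟩ := hg
    refine ⟨A + (∫ ω in Set.Icc (-Real.pi) Real.pi, ‖F ω‖) * Real.exp (Real.pi * 0), fun t => ?_⟩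
    rw [hφ]
    refine (norm_sub_le _ _).trans (add_le_add ?_ ?_)
    · rw [norm_mul, Complex.norm_real, Real.norm_eq_abs, abs_of_pos hA0, ← Complex.ofReal_mul,
        ← Complex.ofReal_sin, Complex.norm_real, Real.norm_eq_abs]
      exact mul_le_of_le_one_right hA0.le (Real.abs_sin_le_one _)
    · rw [hgF]
      exact norm_bandlimited_le hpi.le hF (by simp)
  have hmax : ∀ N : ℕ, ∃ M : ℝ,
      IsGreatest (Set.range fun t : ℝ => ‖samplingSeries φ Λ N testFun (t : ℂ)‖) M ∧
      eLpNorm (fun t : ℝ => samplingSeries φ Λ N testFun (t : ℂ)) ⊤ volume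
        = ENNReal.ofReal M := by
    intro N
    refine exists_isGreatest_norm ?_ ?_
    · unfold samplingSeries
      refine continuous_finsetSum _ fun n _ => continuous_const.mul ?_
      exact (continuous_interpKernel hdφ (hzero n) (hsimple n)).comp Complex.continuous_ofReal
    · unfold samplingSeries
      rw [show (0 : ℂ) = ∑ n ∈ Finset.Icc (-(N : ℤ)) N, testFun (Λ n) * 0 by simp]
      exact tendsto_finsetSum _ fun n _ => (tendsto_interpKernel hB (Λ n)).const_mul _
  choose M hM1 hM2 using hmax
  refine ⟨testFun, testFun_mem, M, hM1, hM2, ?_⟩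
  -- the location of the zeros
  obtain ⟨δ, hδ, hsep⟩ := hsine.separated
  obtain ⟨a₀, b₀, H, ha₀, hb₀, hH, hbd⟩ := hsine.bounds
  have him : ∀ z, φ z = 0 → |z.im| ≤ H := by
    intro z hz
    by_contra! h
    have := (hbd z.re z.im h.le).1
    rw [Complex.re_add_im, hz, norm_zero] at this
    have : 0 < a₀ * Real.exp (Real.pi * |z.im|) := by positivity
    linarith
  have hTC := one_le_testConst
  -- The outer entries are the tolerances of `edgeWeight_le_re_term` for the node and for the
  -- derivative (with `b = A * π`); `δ / 4` keeps two zeros from sharing an integer.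
  set ρ := min (min (1 / (32 * testConst)) (δ / 4)) (A * Real.pi / (32 * testConst)) with hρdef
  have hρ0 : 0 < ρ := by
    rw [hρdef]; positivity
  have hρ1 : ρ ≤ 1 / (32 * testConst) := (min_le_left _ _).trans (min_le_left _ _)
  have hρ2 : ρ ≤ δ / 4 := (min_le_left _ _).trans (min_le_right _ _)
  have hρ3 : ρ ≤ A * Real.pi / (32 * testConst) := min_le_right _ _
  have hρ4 : ρ ≤ 1 / 4 :=
    hρ1.trans (one_div_le_one_div_of_le (by norm_num) (by linarith))
  obtain ⟨R, hR⟩ := exists_zeros_near_int hA0 hφ hgd hgv him hρ0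
  obtain ⟨K, hK⟩ := exists_zero_near_int hA0 hφ hgd hgv
  have hsepΛ : ∀ m n, Λ m ≠ Λ n → δ ≤ ‖Λ m - Λ n‖ := fun m n => hsep _ _ (hzero m) (hzero n)
  have htop := tendsto_re_atTop_of_separated hΛinj hΛmono hδ hsepΛ fun n => him _ (hzero n)
  have hbot := tendsto_re_atBot_of_separated hΛinj hΛmono hδ hsepΛ fun n => him _ (hzero n)
  obtain ⟨n₀, n', hshift⟩ := exists_shift_of_zeros hΛinj hΛrange hΛmono hsep
    (by linarith : 2 * ρ < δ) hρ4 (fun z hz h => (hR z hz h).1) hK htop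
  obtain ⟨R', hR'⟩ := hgv 0 (A / 2) (by linarith)
  -- The margin `5` leaves absolute value at least `4` after rounding, enough for the estimates
  -- valid from `3` on.
  obtain ⟨p₁, hp₁⟩ := eventually_atTop.1 (htop.eventually_ge_atTop (max R (max R' 0 + 5)))
  obtain ⟨p₂, hp₂⟩ := eventually_atBot.1 (hbot.eventually_le_atBot (-(max R 5)))
  obtain ⟨n₁, hn₁0, hn₁', hn₁p, hn₁q⟩ : ∃ n₁ : ℤ, 0 < n₁ ∧ n' ≤ n₁ ∧ p₁ ≤ n₁ ∧ -n₁ ≤ p₂ :=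
    ⟨|n'| + |p₁| + |p₂| + 1, by positivity, by
      linarith [le_abs_self n', abs_nonneg p₁, abs_nonneg p₂], by
      linarith [le_abs_self p₁, abs_nonneg n', abs_nonneg p₂], by
      linarith [neg_abs_le p₂, abs_nonneg n', abs_nonneg p₁]⟩
  have hround : ∀ x : ℝ, |x - round x| ≤ 1 / 2 := abs_sub_round
  have hposR : ∀ n, n₁ ≤ n → max R (max R' 0 + 5) ≤ (Λ n).re := fun n hn => hp₁ n (by omega)
  have hposk : ∀ n, n₁ ≤ n → max R' 0 + 4 ≤ ((n + n₀ : ℤ) : ℝ) := by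
    intro n hn
    have h1 := hround (Λ n).re
    rw [hshift n (by omega)] at h1
    have := (le_max_right _ _).trans (hposR n hn)
    linarith [(abs_le.1 h1).2]
  have hposk' : ∀ n, n₁ ≤ n → 4 ≤ n + n₀ := by
    intro n hn
    have h1 := hposk n hn
    have h2 : (4 : ℝ) ≤ ((n + n₀ : ℤ) : ℝ) := by linarith [le_max_right R' 0]
    exact_mod_cast h2
  have hnegk : ∀ n, n ≤ -n₁ → R ≤ |(Λ n).re| ∧ round (Λ n).re ≤ -4 := by
    intro n hn
    have h1 := hp₂ n (by omega)
    refine ⟨?_, ?_⟩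
    · have := neg_le_abs (Λ n).re
      linarith [le_max_left R 5]
    · have h2 := (abs_le.1 (hround (Λ n).re)).1
      have h3 : ((round (Λ n).re : ℤ) : ℝ) < ((-3 : ℤ) : ℝ) := by
        push_cast
        linarith [le_max_right R 5]
      have : round (Λ n).re < -3 := by exact_mod_cast h3
      omega
  -- the lower bound for the maxima
  set c : ℕ := (n₁ + n₀).toNat with hcdef
  have hc4 := hposk' n₁ le_rfl
  have hcc : (c : ℤ) = n₁ + n₀ := Int.toNat_of_nonneg (by omega)
  have hAp : 0 < A * Real.pi := by positivity
  set C : ℤ → ℝ := fun n => ‖((A * Real.pi : ℝ) : ℂ) * testFun (Λ n) / deriv φ (Λ n)‖ with hCdef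
  set D := ∑ n ∈ Finset.Icc (-n₁) n₁, C n with hDdef
  -- The factor `1 / (2π)` is `(A / 2) / (Aπ)`: the lower bound for `|φ(t)|` over the normalization
  -- of the terms. The argument `L + c` is the integer belonging to `λ_N`, so its weight is the
  -- smallest among the nodes on the right.
  have hlow : ∀ L : ℕ, 1 ≤ L → (1 / (2 * Real.pi)) *
      (edgeWeight (L + c) * Real.log (L + 2) * (1 / 2) - D) ≤ M (n₁.toNat + L) := by
    intro L hL
    set N : ℕ := n₁.toNat + L with hNdef
    have hN : (N : ℤ) = n₁ + L := by
      rw [hNdef]; push_cast; rw [Int.toNat_of_nonneg hn₁0.le]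
    set k : ℤ := N + n₀ with hkdef
    set t : ℝ := (k : ℝ) + 1 / 2 with htdef
    have htc : (t : ℂ) = (k : ℂ) + 1 / 2 := by rw [htdef]; push_cast; ring
    have hkR : max R' 0 + 4 ≤ (k : ℝ) := hposk N (by omega)
    have hφt : A / 2 ≤ ‖φ t‖ := by
      have h1 : ‖g t‖ < A / 2 := by
        refine hR' t ?_ (by simp)
        rw [Complex.ofReal_re]
        refine le_trans ?_ (le_abs_self _)
        linarith [le_max_left R' 0]
      rw [hφ]
      have h2 := norm_sub_norm_le ((A : ℂ) * Complex.sin (Real.pi * t)) (g t)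
      rw [norm_mul, Complex.norm_real, Real.norm_eq_abs, abs_of_pos hA0, htc,
        norm_sin_pi_mul_half_odd, mul_one, ← htc] at h2
      linarith
    have hφt0 : φ t ≠ 0 := norm_pos_iff.1 (by linarith)
    set T : ℤ → ℂ := fun n => ((A * Real.pi : ℝ) : ℂ) * testFun (Λ n)
      / (deriv φ (Λ n) * (t - Λ n)) with hT
    have hseries : samplingSeries φ Λ N testFun t * ((A * Real.pi : ℝ) : ℂ)
        = φ t * ∑ n ∈ Finset.Icc (-(N : ℤ)) N, T n := by
      unfold samplingSeries
      rw [Finset.sum_mul, Finset.mul_sum]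
      refine Finset.sum_congr rfl fun n _ => ?_
      have hne : (t : ℂ) ≠ Λ n := fun h => hφt0 (h ▸ hzero n)
      rw [interpKernel, if_neg hne, hT]
      ring
    have hsum : edgeWeight (L + c) * (1 / 2) * Real.log (L + 2) - D
        ≤ ∑ n ∈ Finset.Icc (-(N : ℤ)) N, (T n).re := by
      refine le_sum_of_le_on_Icc (fun n => norm_nonneg _) hn₁0
        (mul_nonneg (edgeWeight_pos _).le (by norm_num)) hN ?_ ?_ ?_
      · intro n h1 h2
        have hk4 := hposk' n h1
        have hz := hR (Λ n) (hzero n)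
          (((le_max_left _ _).trans (hposR n h1)).trans (le_abs_self _))
        rw [hshift n (by omega)] at hz
        have hnN : (n : ℝ) ≤ N := by exact_mod_cast h2
        have htk : t - ((n + n₀ : ℤ) : ℝ) = N - n + 1 / 2 := by
          rw [htdef, hkdef]; push_cast; ring
        have hterm := edgeWeight_le_re_term hAp (k := n + n₀) (by omega) (hz.1.trans hρ1)
          (by push_cast at hz ⊢; exact hz.2.trans hρ3) (t := t) (by linarith)
        refine le_trans ?_ hterm
        rw [htk]
        have hmono : edgeWeight (L + c) ≤ edgeWeight (n + n₀).natAbs :=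
          edgeWeight_antitone (by omega)
        have hpos := edgeWeight_pos (n + n₀).natAbs
        calc edgeWeight (L + c) * (1 / 2) / ((N : ℝ) - n + 1)
            ≤ edgeWeight (n + n₀).natAbs * (1 / 2) / ((N : ℝ) - n + 1 / 2) := by
              have : (0 : ℝ) < (N : ℝ) - n + 1 / 2 := by linarith
              gcongr
              norm_num
          _ = _ := by
            rw [div_mul_eq_div_div, mul_one_div]
      -- Nodes far to the left need no indexing by integers: only the sign of their terms matters,
      -- and `t` is to their right.
      · intro n h1
        obtain ⟨h2, h3⟩ := hnegk n h1
        have hz := hR (Λ n) (hzero n) h2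
        have h3' : ((round (Λ n).re : ℤ) : ℝ) ≤ -4 := by exact_mod_cast h3
        have ht4 : (4 : ℝ) ≤ k := by linarith [le_max_right R' 0]
        have hterm := edgeWeight_le_re_term hAp (k := round (Λ n).re) (by omega)
          (hz.1.trans hρ1) (by push_cast at hz ⊢; exact hz.2.trans hρ3) (t := t) (by linarith)
        refine le_trans (div_nonneg (edgeWeight_pos _).le ?_) hterm
        linarith
      -- By `1 ≤ L`, the point `t` is at distance at least `1` from the finitely many middle nodes,
      -- so their terms have a bound independent of `N`.
      · intro n h1 h2
        have h3 : (Λ n).re ≤ (Λ n₁).re := hΛmono h2.le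
        have h4 := (abs_le.1 (hround (Λ n₁).re)).2
        rw [hshift n₁ hn₁'] at h4
        have h5 : ((n₁ + n₀ : ℤ) : ℝ) + 1 ≤ k := by
          rw [hkdef, hN]
          push_cast
          have : (1 : ℝ) ≤ L := by exact_mod_cast hL
          linarith
        have h6 : 1 ≤ ‖(t : ℂ) - Λ n‖ := by
          refine le_trans ?_ ((le_abs_self _).trans (Complex.abs_re_le_norm _))
          rw [Complex.sub_re, Complex.ofReal_re]
          linarith
        have h7 : ‖T n‖ ≤ C n := by
          rw [hT, hCdef]
          simp only
          rw [← div_div, norm_div _ ((t : ℂ) - Λ n)]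
          exact div_le_self (norm_nonneg _) h6
        linarith [neg_abs_le (T n).re, Complex.abs_re_le_norm (T n)]
    have hre : edgeWeight (L + c) * Real.log (L + 2) * (1 / 2) - D
        ≤ ‖∑ n ∈ Finset.Icc (-(N : ℤ)) N, T n‖ := by
      refine le_trans (le_trans (by linarith) hsum) ?_
      rw [← Complex.re_sum]
      exact (le_abs_self _).trans (Complex.abs_re_le_norm _)
    have hnorm := congrArg norm hseries
    rw [norm_mul, norm_mul, Complex.norm_real, Real.norm_eq_abs, abs_of_pos hAp] at hnorm
    have hge : ‖samplingSeries φ Λ N testFun t‖ ≤ M N := (hM1 N).2 ⟨t, rfl⟩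
    refine le_trans ?_ hge
    rw [← mul_le_mul_iff_left₀ hAp, hnorm]
    calc _ = A / 2 * (edgeWeight (L + c) * Real.log (L + 2) * (1 / 2) - D) := by
          field_simp
      _ ≤ A / 2 * ‖∑ n ∈ Finset.Icc (-(N : ℤ)) N, T n‖ := by gcongr
      _ ≤ _ := by gcongr
  have hlim : Tendsto (fun L : ℕ => (1 / (2 * Real.pi)) *
      (edgeWeight (L + c) * Real.log (L + 2) * (1 / 2) - D)) atTop atTop :=
    (tendsto_atTop_add_const_right _ (-D)
      ((tendsto_edgeWeight_mul_log_shift (c := c) (by omega)).atTop_mul_const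
        (by norm_num : (0 : ℝ) < 1 / 2))).const_mul_atTop (by positivity)
  have hM : Tendsto (fun L : ℕ => M (n₁.toNat + L)) atTop atTop := by
    refine tendsto_atTop_mono' _ ?_ hlim
    filter_upwards [eventually_ge_atTop 1] with L hL using hlow L hL
  simp_rw [add_comm n₁.toNat] at hM
  exact (tendsto_add_atTop_iff_nat n₁.toNat).1 hM
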